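/- Let $\Gamma$ be a finite, connected, simple metric graph (no loops, at most one edge between two vertices) with vertices $v_1,\dots,v_n$ and edges $e_1,\dots,e_N$, $N\ge 1$. Assume that $\Gamma$ is equilateral: every edge has the same length $l_e\in(0,\infty)$ and is identified with $[0,l_e]$. Let $A$ be the adjacency matrix of $\Gamma$, let $e=(1,\dots,1)^{T}$, and let $Z=\mathrm{Diag}(Ae)^{-1}A$ be the transition matrix. Let $L^2(\Gamma)=\bigoplus_{i=1}^N L^2[0,l_e]$ (with real or complex scalars; the result holds in both cases), and let $L^{st}(\Gamma)$ be the standard (Kirchhoff) Laplacian in $L^2(\Gamma)$: $L^{st}(\Gamma)f=-f''$ on each edge, where the domain consists of all $f=(f_i)\in L^2(\Gamma)$ such that $f_i$ and $f_i'$ are absolutely continuous on $[0,l_e]$, $f_i''\in L^2[0,l_e]$, and at every vertex $v$ the values $f_i(v)$ along all edges incident to $v$ coincide and the derivatives at $v$ along these edges, taken in the outgoing direction, sum to $0$. For an eigenvalue $\lambda$ let $m(\lambda)=\dim\ker(L^{st}(\Gamma)-\lambda)$ be its multiplicity; put $m(\lambda)=0$ if $\lambda$ is not an eigenvalue. Theorem.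 The spectrum of $L^{st}(\Gamma)$ is $$\sigma(L^{st}(\Gamma))=\{0\}\cup\{\lambda>0:\cos(\sqrt\lambda\, l_e)\in\sigma(Z)\}\cup\{\lambda>0:\cos(\sqrt\lambda\, l_e)=-1\},$$ except that the third set has to be omitted when $\Gamma$ is non-bipartite and $N=n$. For every $\lambda\ge 0$ the number $m(\lambda)$ is finite, and $$m(\lambda)=\begin{cases} 1, & \lambda=0,\\ \dim\ker\bigl(Z-\cos(\sqrt\lambda\, l_e)I\bigr), & \lambda>0,\ \sin(\sqrt\lambda\, l_e)\ne 0,\\ N-n+2, & \lambda>0,\ \cos(\sqrt\lambda\, l_e)=1,\\ N-n+2, & \lambda>0,\ \cos(\sqrt\lambda\, l_e)=-1,\ \Gamma\text{ bipartite},\\ N-n, & \lambda>0,\ \cos(\sqrt\lambda\, l_e)=-1,\ \Gamma\text{ non-bipartite}. \end{cases}$$ -/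

import Mathlib

open MeasureTheory Set

/-- A finite (when `V`, `E` are finite) connected simple metric graph with vertex set `V` and edge
set `E`.  The edge `e` joins `source e` to `target e` and is identified with the interval
`[0, length e]`, the endpoint `0` corresponding to `source e` and the endpoint `length e` to
`target e`. -/
structure MetricGraph (V E : Type*) where
  /-- the starting vertex `o(e)` -/
  source : E → V
  /-- the ending vertex `t(e)` -/
  target : E → V
  /-- the edge lengths -/
  length : E → ℝ
  length_pos : ∀ e, 0 < length e
  /-- there are no loops -/
  source_ne_target : ∀ e, source e ≠ target e
  /-- at most one edge joins two given vertices -/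
  edge_injective : Function.Injective fun e => s(source e, target e)
  connected : (SimpleGraph.fromEdgeSet (Set.range fun e => s(source e, target e))).Connected

namespace MetricGraph

variable {V E : Type*} (M : MetricGraph V E)

/-- The underlying combinatorial graph: two vertices are adjacent iff some edge joins them. -/
def graph : SimpleGraph V :=
  SimpleGraph.fromEdgeSet (Set.range fun e => s(M.source e, M.target e))

/-- All edges have length `l`. -/
def IsEquilateral (l : ℝ) : Prop := ∀ e, M.length e = l

/-! ### Matrices -/

section Matrices

variable [Fintype V]

open Classical in
/-- The adjacency matrix `A`. -/
noncomputable def adjacencyMatrix : Matrix V V ℝ := M.graph.adjMatrix ℝ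

/-- The transition matrix `Z = Diag(A e)⁻¹ A`, with `e` the all-ones vector. -/
noncomputable def transitionMatrix [DecidableEq V] : Matrix V V ℝ :=
  (Matrix.diagonal (M.adjacencyMatrix.mulVec 1))⁻¹ * M.adjacencyMatrix

end Matrices

/-! ### The Hilbert space and the operators -/

/-- Lebesgue measure on the interval `[0, length e]`. -/
noncomputable def edgeMeasure (e : E) : Measure ℝ := volume.restrict (Icc 0 (M.length e))

/-- The Hilbert space `L²(Γ) = ⨁ₑ L²[0, length e]`. -/
abbrev L2 (𝕜 : Type*) [RCLike 𝕜] : Type _ :=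
  PiLp 2 fun e : E => Lp 𝕜 2 (M.edgeMeasure e)

variable {𝕜 : Type*} [RCLike 𝕜]

/-- The derivative along each edge, one-sided at the endpoints of `[0, length e]`. -/
noncomputable def edgeDeriv (u : E → ℝ → 𝕜) (e : E) : ℝ → 𝕜 :=
  derivWithin (u e) (Icc 0 (M.length e))

/-- `u` is a representative of `f ∈ L²(Γ)` which, on every edge, is absolutely continuous and
differentiable with absolutely continuous derivative and square integrable second derivative.
(The functions are totally defined on `ℝ`; only their values on `[0, length e]` matter.) -/
structure IsRep (f : M.L2 𝕜) (u : E → ℝ → 𝕜) : Prop where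
  ae_eq : ∀ e, f e =ᵐ[M.edgeMeasure e] u e
  absCont : ∀ e, AbsolutelyContinuousOnInterval (u e) 0 (M.length e)
  differentiableOn : ∀ e, DifferentiableOn ℝ (u e) (Icc 0 (M.length e))
  absCont_deriv : ∀ e, AbsolutelyContinuousOnInterval (M.edgeDeriv u e) 0 (M.length e)
  memLp : ∀ e, MemLp (M.edgeDeriv (M.edgeDeriv u) e) 2 (M.edgeMeasure e)

section Rep

variable {M}

theorem uniqueDiffOn_edge (e : E) : UniqueDiffOn ℝ (Icc 0 (M.length e)) :=
  uniqueDiffOn_Icc (M.length_pos e)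

theorem ae_differentiableWithinAt {v : ℝ → 𝕜} {e : E}
    (hv : AbsolutelyContinuousOnInterval v 0 (M.length e)) :
    ∀ᵐ x ∂(M.edgeMeasure e), DifferentiableWithinAt ℝ v (Icc 0 (M.length e)) x := by
  have h := hv.boundedVariationOn
  rw [uIcc_of_le (M.length_pos e).le] at h
  have h' := h.locallyBoundedVariationOn.ae_differentiableWithinAt_of_mem
  exact (ae_restrict_iff' measurableSet_Icc).2 h'

theorem edgeDeriv_congr {u v : E → ℝ → 𝕜} {e : E} (h : EqOn (u e) (v e) (Icc 0 (M.length e))) :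
    EqOn (M.edgeDeriv u e) (M.edgeDeriv v e) (Icc 0 (M.length e)) := fun _ hx =>
  derivWithin_congr h (h hx)

theorem edgeDeriv_add {u v : E → ℝ → 𝕜} {e : E} {x : ℝ}
    (hu : DifferentiableWithinAt ℝ (u e) (Icc 0 (M.length e)) x)
    (hv : DifferentiableWithinAt ℝ (v e) (Icc 0 (M.length e)) x) :
    M.edgeDeriv (u + v) e x = M.edgeDeriv u e x + M.edgeDeriv v e x :=
  derivWithin_add hu hv

theorem edgeDeriv_smul (c : 𝕜) (u : E → ℝ → 𝕜) (e : E) (x : ℝ) :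
    M.edgeDeriv (c • u) e x = c * M.edgeDeriv u e x := by
  have := derivWithin_const_mul_field (𝕜 := ℝ) (s := Icc 0 (M.length e)) (x := x) (v := u e) c
  exact this

theorem absCont_congr {u v : ℝ → 𝕜} {l : ℝ} (hl : 0 < l) (h : EqOn u v (Icc 0 l))
    (hu : AbsolutelyContinuousOnInterval u 0 l) : AbsolutelyContinuousOnInterval v 0 l := by
  rw [absolutelyContinuousOnInterval_iff] at hu ⊢
  intro ε hε
  obtain ⟨δ, hδ, H⟩ := hu ε hε
  refine ⟨δ, hδ, fun I hI hs => ?_⟩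
  have := H I hI hs
  rw [← uIcc_of_le hl.le] at h
  rwa [Finset.sum_congr rfl fun i hi => by
    rw [h (hI.1 i hi).1, h (hI.1 i hi).2]] at this

theorem IsRep.eqOn {f : M.L2 𝕜} {u v : E → ℝ → 𝕜} (hu : M.IsRep f u) (hv : M.IsRep f v) (e : E) :
    EqOn (u e) (v e) (Icc 0 (M.length e)) :=
  Measure.eqOn_Icc_of_ae_eq volume (M.length_pos e).ne
    ((hu.ae_eq e).symm.trans (hv.ae_eq e))
    (hu.differentiableOn e).continuousOn (hv.differentiableOn e).continuousOn

theorem IsRep.edgeDeriv_add_eqOn {f g : M.L2 𝕜} {u v : E → ℝ → 𝕜} (hu : M.IsRep f u)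
    (hv : M.IsRep g v) (e : E) :
    EqOn (M.edgeDeriv (u + v) e) (M.edgeDeriv u e + M.edgeDeriv v e) (Icc 0 (M.length e)) :=
  fun x hx => edgeDeriv_add (hu.differentiableOn e x hx) (hv.differentiableOn e x hx)

theorem IsRep.edgeDeriv₂_add {f g : M.L2 𝕜} {u v : E → ℝ → 𝕜} (hu : M.IsRep f u)
    (hv : M.IsRep g v) (e : E) :
    M.edgeDeriv (M.edgeDeriv (u + v)) e =ᵐ[M.edgeMeasure e]
      M.edgeDeriv (M.edgeDeriv u) e + M.edgeDeriv (M.edgeDeriv v) e := by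
  have hmem : ∀ᵐ x ∂(M.edgeMeasure e), x ∈ Icc 0 (M.length e) :=
    ae_restrict_mem measurableSet_Icc
  filter_upwards [hmem, ae_differentiableWithinAt (hu.absCont_deriv e),
    ae_differentiableWithinAt (hv.absCont_deriv e)] with x hx h1 h2
  have : M.edgeDeriv (M.edgeDeriv (u + v)) e x
      = M.edgeDeriv (M.edgeDeriv u + M.edgeDeriv v) e x :=
    edgeDeriv_congr (hu.edgeDeriv_add_eqOn hv e) hx
  rw [this, edgeDeriv_add h1 h2]
  rfl

theorem edgeDeriv₂_smul (c : 𝕜) (u : E → ℝ → 𝕜) (e : E) :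
    M.edgeDeriv (M.edgeDeriv (c • u)) e = c • M.edgeDeriv (M.edgeDeriv u) e := by
  have h : M.edgeDeriv (c • u) = c • M.edgeDeriv u := by
    funext e x
    exact edgeDeriv_smul c u e x
  rw [h]
  funext x
  exact edgeDeriv_smul c _ e x

theorem IsRep.zero : M.IsRep (0 : M.L2 𝕜) 0 where
  ae_eq e := Lp.coeFn_zero _ _ _
  absCont e := by
    rw [absolutelyContinuousOnInterval_iff]
    exact fun ε hε => ⟨1, one_pos, fun I _ _ => by simpa using hε⟩
  differentiableOn e := differentiableOn_const 0
  absCont_deriv e := by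
    rw [absolutelyContinuousOnInterval_iff]
    exact fun ε hε => ⟨1, one_pos, fun I _ _ => by simpa [edgeDeriv] using hε⟩
  memLp e := by
    have : M.edgeDeriv (M.edgeDeriv (0 : E → ℝ → 𝕜)) e = 0 := by
      have := edgeDeriv₂_smul (M := M) (0 : 𝕜) (0 : E → ℝ → 𝕜) e
      simpa using this
    rw [this]
    exact MemLp.zero

theorem IsRep.add {f g : M.L2 𝕜} {u v : E → ℝ → 𝕜} (hu : M.IsRep f u) (hv : M.IsRep g v) :
    M.IsRep (f + g) (u + v) where
  ae_eq e := (Lp.coeFn_add (f e) (g e)).trans ((hu.ae_eq e).add (hv.ae_eq e))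
  absCont e := (hu.absCont e).add (hv.absCont e)
  differentiableOn e := (hu.differentiableOn e).add (hv.differentiableOn e)
  absCont_deriv e := absCont_congr (M.length_pos e) (hu.edgeDeriv_add_eqOn hv e).symm
    ((hu.absCont_deriv e).add (hv.absCont_deriv e))
  memLp e := ((hu.memLp e).add (hv.memLp e)).ae_eq (hu.edgeDeriv₂_add hv e).symm

theorem IsRep.smul (c : 𝕜) {f : M.L2 𝕜} {u : E → ℝ → 𝕜} (hu : M.IsRep f u) :
    M.IsRep (c • f) (c • u) where
  ae_eq e := (Lp.coeFn_smul c (f e)).trans ((hu.ae_eq e).const_smul c)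
  absCont e := (hu.absCont e).const_smul c
  differentiableOn e := (hu.differentiableOn e).const_smul c
  absCont_deriv e := by
    have h : M.edgeDeriv (c • u) e = fun x => c • M.edgeDeriv u e x := by
      funext x
      exact edgeDeriv_smul c u e x
    rw [h]
    exact (hu.absCont_deriv e).const_smul c
  memLp e := by
    rw [edgeDeriv₂_smul]
    exact (hu.memLp e).const_smul c

/-- `-u''` as an element of `L²(Γ)`. -/
noncomputable def IsRep.negSecondDeriv {f : M.L2 𝕜} {u : E → ℝ → 𝕜} (hu : M.IsRep f u) : M.L2 𝕜 :=
  WithLp.toLp 2 fun e => -(hu.memLp e).toLp _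

theorem IsRep.negSecondDeriv_eq {f : M.L2 𝕜} {u v : E → ℝ → 𝕜} (hu : M.IsRep f u)
    (hv : M.IsRep f v) : hu.negSecondDeriv = hv.negSecondDeriv := by
  unfold IsRep.negSecondDeriv
  congr 1
  funext e
  congr 1
  refine MemLp.toLp_congr _ _ ?_
  have hmem : ∀ᵐ x ∂(M.edgeMeasure e), x ∈ Icc 0 (M.length e) :=
    ae_restrict_mem measurableSet_Icc
  filter_upwards [hmem] with x hx
  exact edgeDeriv_congr (edgeDeriv_congr (hu.eqOn hv e)) hx

theorem IsRep.negSecondDeriv_add {f g : M.L2 𝕜} {u v : E → ℝ → 𝕜} (hu : M.IsRep f u)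
    (hv : M.IsRep g v) :
    (hu.add hv).negSecondDeriv = hu.negSecondDeriv + hv.negSecondDeriv := by
  ext1 e
  change -(((hu.add hv).memLp e).toLp _) = -((hu.memLp e).toLp _) + -((hv.memLp e).toLp _)
  rw [← neg_add, ← MemLp.toLp_add]
  congr 1
  exact MemLp.toLp_congr _ _ (hu.edgeDeriv₂_add hv e)

theorem IsRep.negSecondDeriv_smul (c : 𝕜) {f : M.L2 𝕜} {u : E → ℝ → 𝕜} (hu : M.IsRep f u) :
    (hu.smul c).negSecondDeriv = c • hu.negSecondDeriv := by
  ext1 e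
  change -(((hu.smul c).memLp e).toLp _) = c • -((hu.memLp e).toLp _)
  rw [smul_neg, ← MemLp.toLp_const_smul]
  congr 1
  exact MemLp.toLp_congr _ _ (by rw [edgeDeriv₂_smul])

end Rep

variable (𝕜)

/-- The maximal Laplace operator `f ↦ -f''` in `L²(Γ)`. -/
noncomputable def maxLaplacian : M.L2 𝕜 →ₗ.[𝕜] M.L2 𝕜 where
  domain :=
    { carrier := {f | ∃ u, M.IsRep f u}
      add_mem' := fun ⟨_, hu⟩ ⟨_, hv⟩ => ⟨_, hu.add hv⟩
      zero_mem' := ⟨_, IsRep.zero⟩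
      smul_mem' := fun c _ ⟨_, hu⟩ => ⟨_, hu.smul c⟩ }
  toFun :=
    { toFun := fun f => (Classical.choose_spec f.2).negSecondDeriv
      map_add' := fun f g => by
        rw [← IsRep.negSecondDeriv_add]
        exact IsRep.negSecondDeriv_eq _ _
      map_smul' := fun c f => by
        rw [RingHom.id_apply, ← IsRep.negSecondDeriv_smul]
        exact IsRep.negSecondDeriv_eq _ _ }

/-- The value of `maxLaplacian` does not depend on the representative. -/
theorem maxLaplacian_apply (f : (M.maxLaplacian 𝕜).domain) {u : E → ℝ → 𝕜}
    (hu : M.IsRep (f : M.L2 𝕜) u) : M.maxLaplacian 𝕜 f = hu.negSecondDeriv :=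
  IsRep.negSecondDeriv_eq (Classical.choose_spec f.2) hu

variable {𝕜}

open Classical in
/-- The value at the vertex `v` of the restriction of `u` to an edge `e` incident to `v`. -/
noncomputable def valueAt (u : E → ℝ → 𝕜) (v : V) (e : E) : 𝕜 :=
  if v = M.source e then u e 0 else if v = M.target e then u e (M.length e) else 0

open Classical in
/-- The derivative at the vertex `v` of the restriction of `u` to an edge `e` incident to `v`,
taken in the outgoing direction (away from `v`); it is `0` if `e` is not incident to `v`. -/
noncomputable def outDerivAt (u : E → ℝ → 𝕜) (v : V) (e : E) : 𝕜 :=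
  if v = M.source e then M.edgeDeriv u e 0
  else if v = M.target e then -M.edgeDeriv u e (M.length e) else 0

/-- The standard (Kirchhoff) vertex conditions: at each vertex `v`, the values along all incident
edges agree and the outgoing derivatives along all incident edges sum to `0`. -/
structure IsStandard [Fintype E] (u : E → ℝ → 𝕜) : Prop where
  continuous : ∀ (v : V) (e e' : E), v ∈ s(M.source e, M.target e) →
    v ∈ s(M.source e', M.target e') → M.valueAt u v e = M.valueAt u v e'
  kirchhoff : ∀ v : V, ∑ e, M.outDerivAt u v e = 0

section Standard

variable {M}

theorem IsRep.outDerivAt_add {f g : M.L2 𝕜} {u w : E → ℝ → 𝕜} (hu : M.IsRep f u)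
    (hw : M.IsRep g w) (v : V) (e : E) :
    M.outDerivAt (u + w) v e = M.outDerivAt u v e + M.outDerivAt w v e := by
  have h0 := hu.edgeDeriv_add_eqOn hw e (left_mem_Icc.2 (M.length_pos e).le)
  have h1 := hu.edgeDeriv_add_eqOn hw e (right_mem_Icc.2 (M.length_pos e).le)
  unfold outDerivAt
  split_ifs
  · simpa using h0
  · simp [h1, add_comm]
  · simp

theorem outDerivAt_smul (c : 𝕜) (u : E → ℝ → 𝕜) (v : V) (e : E) :
    M.outDerivAt (c • u) v e = c * M.outDerivAt u v e := by
  unfold outDerivAt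
  split_ifs <;> simp [edgeDeriv_smul]

theorem valueAt_add (u w : E → ℝ → 𝕜) (v : V) (e : E) :
    M.valueAt (u + w) v e = M.valueAt u v e + M.valueAt w v e := by
  unfold valueAt
  split_ifs <;> simp

theorem valueAt_smul (c : 𝕜) (u : E → ℝ → 𝕜) (v : V) (e : E) :
    M.valueAt (c • u) v e = c * M.valueAt u v e := by
  unfold valueAt
  split_ifs <;> simp

end Standard

variable (𝕜) [Fintype E]

/-- The elements of the maximal domain satisfying the standard vertex conditions. -/
def standardDomain : Submodule 𝕜 (M.L2 𝕜) where
  carrier := {f | ∃ u, M.IsRep f u ∧ M.IsStandard u}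
  add_mem' := fun ⟨u, hu, hu'⟩ ⟨w, hw, hw'⟩ => ⟨u + w, hu.add hw,
    { continuous := fun v e e' he he' => by
        rw [valueAt_add, valueAt_add, hu'.continuous v e e' he he', hw'.continuous v e e' he he']
      kirchhoff := fun v => by
        simp only [hu.outDerivAt_add hw, Finset.sum_add_distrib, hu'.kirchhoff, hw'.kirchhoff,
          add_zero] }⟩
  zero_mem' := ⟨0, IsRep.zero,
    { continuous := fun v e e' _ _ => by simp [valueAt]
      kirchhoff := fun v => by
        have : ∀ e, M.outDerivAt (0 : E → ℝ → 𝕜) v e = 0 := fun e => by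
          have := outDerivAt_smul (M := M) (0 : 𝕜) (0 : E → ℝ → 𝕜) v e
          simpa using this
        simp [this] }⟩
  smul_mem' := fun c _ ⟨u, hu, hu'⟩ => ⟨c • u, hu.smul c,
    { continuous := fun v e e' he he' => by
        rw [valueAt_smul, valueAt_smul, hu'.continuous v e e' he he']
      kirchhoff := fun v => by
        simp only [outDerivAt_smul, ← Finset.mul_sum, hu'.kirchhoff, mul_zero] }⟩

/-- The standard (Kirchhoff) Laplace operator `L^{st}(Γ)` in `L²(Γ)`. -/
noncomputable def standardLaplacian : M.L2 𝕜 →ₗ.[𝕜] M.L2 𝕜 :=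
  (M.maxLaplacian 𝕜).domRestrict (M.standardDomain 𝕜)

end MetricGraph

/-! ### Spectrum and eigenspaces of unbounded operators -/

namespace LinearPMap

variable {𝕜 H : Type*} [RCLike 𝕜] [NormedAddCommGroup H] [NormedSpace 𝕜 H]

/-- The resolvent set of an unbounded operator `T`: those `z` for which `T - z` is a bijection of
the domain of `T` onto `H` with bounded inverse `R`. -/
def unboundedResolventSet (T : H →ₗ.[𝕜] H) : Set 𝕜 :=
  {z | ∃ R : H →L[𝕜] H,
    (∀ g : H, ∃ h : R g ∈ T.domain, T ⟨R g, h⟩ - z • R g = g) ∧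
    ∀ f : T.domain, R (T f - z • (f : H)) = f}

/-- The spectrum of an unbounded operator. -/
def unboundedSpectrum (T : H →ₗ.[𝕜] H) : Set 𝕜 := T.unboundedResolventSetᶜ

/-- The eigenspace `ker (T - z)` of an unbounded operator. -/
def unboundedEigenspace (T : H →ₗ.[𝕜] H) (z : 𝕜) : Submodule 𝕜 H where
  carrier := {f | ∃ h : f ∈ T.domain, T ⟨f, h⟩ = z • f}
  add_mem' := by
    rintro f g ⟨hf, ef⟩ ⟨hg, eg⟩
    refine ⟨T.domain.add_mem hf hg, ?_⟩
    have := T.map_add ⟨f, hf⟩ ⟨g, hg⟩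
    rw [ef, eg, ← smul_add] at this
    exact this
  zero_mem' := ⟨T.domain.zero_mem, by
    rw [smul_zero]
    exact T.map_zero⟩
  smul_mem' := by
    rintro c f ⟨hf, ef⟩
    refine ⟨T.domain.smul_mem c hf, ?_⟩
    have := T.map_smul c ⟨f, hf⟩
    rw [ef, smul_comm] at this
    exact this

end LinearPMap

/-! ### Absolutely continuous functions -/

/-! On one edge every solution of `-u'' = z u` is `a C + b S`, where `C`, `S` have initial data `(1,
0)` and `(0, 1)`. An eigenfunction is therefore encoded by its initial values `a`, its initial
derivatives `b` and its vertex values `c`, subject to the finite linear system `vertexSystem`; the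
kernel of this system is isomorphic to the eigenspace (`kerEquivEigenspace`).

The system is square, with `2|E| + |V|` unknowns and equations. If its kernel is trivial it can be
solved for any right-hand side, so an edgewise solution of `-u'' - z u = g` can be corrected to
satisfy the vertex conditions. This gives a bounded resolvent, and the spectrum consists of
eigenvalues only (`mem_spectrum_iff`). Integration by parts (`energy_identity`) shows `z = ‖u'‖² /
‖u‖²`, so eigenvalues are real and nonnegative.

Let `λ = k² > 0`, so that `C l = cos (k l)` and `S l = sin (k l) / k`. If `S l ≠ 0`, the vertex
values determine the function, and the Kirchhoff condition becomes `(Z - cos (k l)) c = 0`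
(`finrank_ker_vertexSystem_of_ne_zero`). If `S l = 0`, then `σ = C l = ±1` and the system decouples
(`finrank_ker_vertexSystem_of_eq_zero`): `b` lies in the kernel of a signed incidence matrix and `c`
in the kernel of its transpose. Rank-nullity gives the dimension `N - n + 2 d`, with `d` the
dimension of the second kernel. By connectedness `d = 1` if `σ = 1`, or if `σ = -1` and the graph is
bipartite; otherwise `d = 0`. For `λ = 0` the energy argument leaves only constants.

The formula for the spectrum says where these multiplicities are positive; it uses `n ≤ N + 1`, `1 ∈
σ(Z)`, and `-1 ∉ σ(Z)` for non-bipartite graphs. -/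

theorem AbsolutelyContinuousOnInterval.comp_lipschitzWith {X Y : Type*} [PseudoMetricSpace X]
    [PseudoMetricSpace Y] {f : ℝ → X} {φ : X → Y} {a b : ℝ} (hφ : LipschitzWith 1 φ)
    (hf : AbsolutelyContinuousOnInterval f a b) :
    AbsolutelyContinuousOnInterval (fun x => φ (f x)) a b := by
  rw [absolutelyContinuousOnInterval_iff] at hf ⊢
  intro ε hε
  obtain ⟨δ, hδ, H⟩ := hf ε hε
  refine ⟨δ, hδ, fun I hI hs => (Finset.sum_le_sum fun i _ => ?_).trans_lt (H I hI hs)⟩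
  simpa using hφ.dist_le_mul (f (I.2 i).1) (f (I.2 i).2)

theorem absolutelyContinuousOnInterval_of_hasDerivWithinAt {F : Type*} [NormedAddCommGroup F]
    [NormedSpace ℝ F] {f f' : ℝ → F} {l : ℝ} (hl : 0 < l)
    (hf : ∀ t ∈ Icc 0 l, HasDerivWithinAt f (f' t) (Icc 0 l) t)
    (hf' : ContinuousOn f' (Icc 0 l)) : AbsolutelyContinuousOnInterval f 0 l := by
  apply ContDiffOn.absolutelyContinuousOnInterval
  rw [uIcc_of_le hl.le, contDiffOn_one_iff_derivWithin (uniqueDiffOn_Icc hl)]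
  refine ⟨fun t ht => (hf t ht).differentiableWithinAt, hf'.congr fun t ht => ?_⟩
  exact (hf t ht).derivWithin (uniqueDiffOn_Icc hl t ht)

/-- Real and imaginary parts reduce this to real primitives; the embedding `ℝ → 𝕜` is 1-Lipschitz
and carries absolute continuity back. -/
theorem IntervalIntegrable.absolutelyContinuousOnInterval_integral {𝕜 : Type*} [RCLike 𝕜]
    {f : ℝ → 𝕜} {l : ℝ} (hl : 0 < l) (h : IntervalIntegrable f volume 0 l) :
    AbsolutelyContinuousOnInterval (fun x => ∫ s in 0..x, f s) 0 l := by
  have hre : IntervalIntegrable (fun s => RCLike.re (f s)) volume 0 l := ⟨h.1.re, h.2.re⟩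
  have him : IntervalIntegrable (fun s => RCLike.im (f s)) volume 0 l := ⟨h.1.im, h.2.im⟩
  have hof : LipschitzWith 1 (fun x : ℝ => (x : 𝕜)) :=
    LipschitzWith.of_dist_le_mul fun x y => by
      rw [dist_eq_norm, ← map_sub, RCLike.norm_ofReal, dist_eq_norm, Real.norm_eq_abs,
        NNReal.coe_one, one_mul]
  have h1 := (hre.absolutelyContinuousOnInterval_intervalIntegral
    left_mem_uIcc).comp_lipschitzWith hof
  have h2 := ((him.absolutelyContinuousOnInterval_intervalIntegral
    left_mem_uIcc).comp_lipschitzWith hof).const_smul (RCLike.I : 𝕜)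
  refine MetricGraph.absCont_congr hl (fun x hx => ?_) (h1.add h2)
  have hx' : IntervalIntegrable f volume 0 x := h.mono_set (uIcc_subset_uIcc_left
    (by rwa [uIcc_of_le hl.le]))
  have i1 : IntervalIntegrable (fun s => ((RCLike.re (f s) : ℝ) : 𝕜)) volume 0 x :=
    ⟨hx'.1.re.ofReal, hx'.2.re.ofReal⟩
  have i2 : IntervalIntegrable (fun s => ((RCLike.im (f s) : ℝ) : 𝕜)) volume 0 x :=
    ⟨hx'.1.im.ofReal, hx'.2.im.ofReal⟩
  have e1 : (fun s => f s) = fun s => ((RCLike.re (f s) : ℝ) : 𝕜) +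
      RCLike.I * ((RCLike.im (f s) : ℝ) : 𝕜) := by
    funext s
    rw [mul_comm, RCLike.re_add_im]
  rw [e1, intervalIntegral.integral_add i1 (i2.const_mul _), intervalIntegral.integral_const_mul]
  simp only [intervalIntegral.intervalIntegral_eq_integral_uIoc, integral_ofReal, Pi.add_apply,
    smul_eq_mul, RCLike.real_smul_eq_coe_mul, map_mul]

/-! ### Fundamental systems of `-u'' = z u` -/

/-- The solutions `C`, `S` of `-u'' = z u` with initial data `(1, 0)` and `(0, 1)` at `0`. -/
structure IsFundamentalPair {𝕜 : Type*} [RCLike 𝕜] (z : 𝕜) (C S : ℝ → 𝕜) : Prop where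
  hasDerivAt_C : ∀ t, HasDerivAt C (-(z * S t)) t
  hasDerivAt_S : ∀ t, HasDerivAt S (C t) t
  C_zero : C 0 = 1
  S_zero : S 0 = 0

namespace IsFundamentalPair

variable {𝕜 : Type*} [RCLike 𝕜] {z : 𝕜} {C S : ℝ → 𝕜}

theorem continuous_C (h : IsFundamentalPair z C S) : Continuous C :=
  continuous_iff_continuousAt.2 fun t => (h.hasDerivAt_C t).continuousAt

theorem continuous_S (h : IsFundamentalPair z C S) : Continuous S :=
  continuous_iff_continuousAt.2 fun t => (h.hasDerivAt_S t).continuousAt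

/-- The derivative of the left side vanishes. The identity says that the propagator of `(u, u')` has
determinant one. -/
theorem wronskian (h : IsFundamentalPair z C S) (t : ℝ) : C t * C t + z * S t * S t = 1 := by
  have hd : ∀ t, HasDerivAt (fun t => C t * C t + z * S t * S t) 0 t := fun t => by
    convert! (((h.hasDerivAt_C t).mul (h.hasDerivAt_C t)).add
      (((h.hasDerivAt_S t).const_mul z).mul (h.hasDerivAt_S t))) using 1
    ring
  have := is_const_of_deriv_eq_zero (fun t => (hd t).differentiableAt) (fun t => (hd t).deriv) t 0
  simpa [h.C_zero, h.S_zero] using this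

/-- Every solution on an interval is determined by its initial data. -/
theorem eq_of_hasDerivWithinAt (h : IsFundamentalPair z C S) {l : ℝ} {u v : ℝ → 𝕜}
    (hu : ∀ t ∈ Icc 0 l, HasDerivWithinAt u (v t) (Icc 0 l) t)
    (hv : ∀ t ∈ Icc 0 l, HasDerivWithinAt v (-(z * u t)) (Icc 0 l) t) {t : ℝ} (ht : t ∈ Icc 0 l) :
    u t = u 0 * C t + v 0 * S t ∧ v t = u 0 * -(z * S t) + v 0 * C t := by
  -- The two combinations apply the inverse propagator to `(u, v)`, so they are constants of motion;
  -- the Wronskian identity inverts them again at the end.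
  have h1 : ∀ t ∈ Icc 0 l, HasDerivWithinAt (fun t => C t * u t - S t * v t) 0 (Icc 0 l) t :=
    fun t ht => by
      convert! (((h.hasDerivAt_C t).hasDerivWithinAt).mul (hu t ht)).sub
        (((h.hasDerivAt_S t).hasDerivWithinAt).mul (hv t ht)) using 1
      ring
  have h2 : ∀ t ∈ Icc 0 l, HasDerivWithinAt (fun t => z * S t * u t + C t * v t) 0 (Icc 0 l) t :=
    fun t ht => by
      convert! ((((h.hasDerivAt_S t).hasDerivWithinAt).const_mul z).mul (hu t ht)).add
        (((h.hasDerivAt_C t).hasDerivWithinAt).mul (hv t ht)) using 1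
      ring
  have key : ∀ φ : ℝ → 𝕜, (∀ t ∈ Icc 0 l, HasDerivWithinAt φ 0 (Icc 0 l) t) → φ t = φ 0 :=
    fun φ hφ => constant_of_derivWithin_zero (fun t ht => (hφ t ht).differentiableWithinAt)
      (fun t ht => (hφ t (Ico_subset_Icc_self ht)).derivWithin
        (uniqueDiffOn_Icc (ht.1.trans_lt ht.2) t (Ico_subset_Icc_self ht))) t ht
  have e1 := key _ h1
  have e2 := key _ h2
  simp only [h.C_zero, h.S_zero] at e1 e2
  have w := h.wronskian t
  constructor
  · linear_combination C t * e1 + S t * e2 - u t * w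
  · linear_combination (-(z * S t)) * e1 + C t * e2 - v t * w

/-- A fundamental pair exists for every `z`. -/
theorem exists_pair (z : 𝕜) : ∃ C S : ℝ → 𝕜, IsFundamentalPair z C S := by
  -- Generator of the first-order system `(u, u')' = (u', -z u)`. The orbit of `(0, 1)` under its
  -- exponential is `(S, S')`, and `S' = C`, so one orbit supplies both functions.
  let B : (𝕜 × 𝕜) →L[ℝ] (𝕜 × 𝕜) :=
    (ContinuousLinearMap.snd ℝ 𝕜 𝕜).prod (-(z • ContinuousLinearMap.fst ℝ 𝕜 𝕜))
  let Φ : ℝ → ((𝕜 × 𝕜) →L[ℝ] (𝕜 × 𝕜)) := fun t => NormedSpace.exp (t • B)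
  have hΦ : ∀ x t, HasDerivAt (fun t => Φ t x) (B (Φ t x)) t := fun x t => by
    have h1 := hasDerivAt_exp_smul_const' (𝕂 := ℝ) B t
    exact (ContinuousLinearMap.apply ℝ (𝕜 × 𝕜) x).hasFDerivAt.comp_hasDerivAt t h1
  have hΦ0 : ∀ x, Φ 0 x = x := fun x => by
    have h0 : (0 : ℝ) • B = 0 := zero_smul ℝ B
    change NormedSpace.exp ((0 : ℝ) • B) x = x
    rw [h0, NormedSpace.exp_zero, one_apply_eq_self]
  refine ⟨fun t => (Φ t (0, 1)).2, fun t => (Φ t (0, 1)).1, fun t => ?_, fun t => ?_, ?_, ?_⟩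
  · exact (ContinuousLinearMap.snd ℝ 𝕜 𝕜).hasFDerivAt.comp_hasDerivAt t (hΦ (0, 1) t)
  · exact (ContinuousLinearMap.fst ℝ 𝕜 𝕜).hasFDerivAt.comp_hasDerivAt t (hΦ (0, 1) t)
  · simp [hΦ0]
  · simp [hΦ0]

/-- The trigonometric fundamental pair. -/
theorem trigonometric {k : ℝ} (hk : k ≠ 0) :
    IsFundamentalPair ((k ^ 2 : ℝ) : 𝕜) (fun t => (Real.cos (k * t) : 𝕜))
      (fun t => ((Real.sin (k * t) / k : ℝ) : 𝕜)) where
  hasDerivAt_C t := by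
    have h : HasDerivAt (fun t => Real.cos (k * t)) (-(k ^ 2 * (Real.sin (k * t) / k))) t := by
      convert! ((hasDerivAt_id t).const_mul k).cos using 1
      simp
      field_simp
    convert! (RCLike.ofRealCLM (K := 𝕜)).hasFDerivAt.comp_hasDerivAt t h using 1
    simp
  hasDerivAt_S t := by
    have h : HasDerivAt (fun t => Real.sin (k * t) / k) (Real.cos (k * t)) t := by
      convert! (((hasDerivAt_id t).const_mul k).sin).div_const k using 1
      simp
      field_simp
    exact (RCLike.ofRealCLM (K := 𝕜)).hasFDerivAt.comp_hasDerivAt t h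
  C_zero := by simp
  S_zero := by simp

end IsFundamentalPair

/-! ### The inhomogeneous initial value problem on one edge -/

section Particular

variable {𝕜 : Type*} [RCLike 𝕜]

/-- The extension by zero of an element of `L²[0, l]`. -/
noncomputable def extendByZero {l : ℝ} (g : Lp 𝕜 2 (volume.restrict (Icc 0 l))) : ℝ → 𝕜 :=
  (Icc 0 l).indicator g

variable {l : ℝ} (g : Lp 𝕜 2 (volume.restrict (Icc 0 l)))

theorem integrable_coe : Integrable g (volume.restrict (Icc 0 l)) :=
  (Lp.memLp g).integrable (by norm_num)

theorem integrable_extendByZero : Integrable (extendByZero g) :=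
  (integrable_indicator_iff measurableSet_Icc).2 (integrable_coe g)

/-- Hölder's inequality on an interval of length `l` compares the `L¹` and `L²` norms. -/
theorem integral_norm_extendByZero_le :
    ∫ s, ‖extendByZero g s‖ ≤ (√l) * ‖g‖ := by
  have h0 : ∫ s, ‖extendByZero g s‖ = ∫ s in Icc 0 l, ‖g s‖ := by
    rw [← integral_indicator measurableSet_Icc]
    congr 1
    funext s
    exact norm_indicator_eq_indicator_norm _ _
  have h1 := eLpNorm_le_eLpNorm_mul_rpow_measure_univ (p := 1) (q := 2)
    (by norm_num : (1 : ENNReal) ≤ 2) (Lp.aestronglyMeasurable g)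
  rw [h0, integral_norm_eq_lintegral_enorm (Lp.aestronglyMeasurable g),
    ← eLpNorm_one_eq_lintegral_enorm, Lp.norm_def, mul_comm]
  refine (ENNReal.toReal_mono ?_ h1).trans ?_
  · exact ENNReal.mul_ne_top (Lp.eLpNorm_ne_top g) (ENNReal.rpow_ne_top_of_nonneg (by norm_num)
      (measure_ne_top _ _))
  · rw [ENNReal.toReal_mul]
    refine mul_le_mul_of_nonneg_left (le_of_eq ?_) ENNReal.toReal_nonneg
    rw [← ENNReal.toReal_rpow, Measure.restrict_apply_univ, Real.volume_Icc, sub_zero,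
      ENNReal.toReal_ofReal']
    -- No sign of `l` is assumed; for negative `l` the interval is empty and the real square root is
    -- zero.
    have hs : √l = √(max l 0) := by
      rcases le_total 0 l with h | h
      · rw [max_eq_left h]
      · rw [max_eq_right h, Real.sqrt_eq_zero_of_nonpos h, Real.sqrt_zero]
    rw [hs, Real.sqrt_eq_rpow]
    norm_num

/-- The primitive of `g` vanishing at `0`. -/
noncomputable def primitive : Lp 𝕜 2 (volume.restrict (Icc 0 l)) →ₗ[𝕜] (ℝ → 𝕜) where
  -- Extending by zero makes the primitive continuous on all of `ℝ`. Linearity needs a.e. arguments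
  -- because the chosen representatives of `f + g` and `c • g` are additive and homogeneous only
  -- a.e.
  toFun g t := ∫ s in 0..t, extendByZero g s
  map_add' f g := by
    funext t
    rw [Pi.add_apply, ← intervalIntegral.integral_add (integrable_extendByZero f).intervalIntegrable
      (integrable_extendByZero g).intervalIntegrable]
    refine intervalIntegral.integral_congr_ae (ae_of_ae_restrict_of_ae_restrict_compl
      (Icc 0 l) ?_ ?_)
    · filter_upwards [Lp.coeFn_add f g, ae_restrict_mem measurableSet_Icc] with s hs hm _
      simpa [extendByZero, hm] using hs
    · filter_upwards [ae_restrict_mem measurableSet_Icc.compl] with s hm _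
      simp [extendByZero, indicator_of_notMem hm]
  map_smul' c g := by
    funext t
    rw [Pi.smul_apply, RingHom.id_apply, ← intervalIntegral.integral_smul]
    refine intervalIntegral.integral_congr_ae (ae_of_ae_restrict_of_ae_restrict_compl
      (Icc 0 l) ?_ ?_)
    · filter_upwards [Lp.coeFn_smul c g, ae_restrict_mem measurableSet_Icc] with s hs hm _
      simpa [extendByZero, hm] using hs
    · filter_upwards [ae_restrict_mem measurableSet_Icc.compl] with s hm _
      simp [extendByZero, indicator_of_notMem hm]

theorem continuous_primitive : Continuous (primitive g) :=
  intervalIntegral.continuous_primitive (fun _ _ => (integrable_extendByZero g).intervalIntegrable)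
    0

theorem norm_primitive_le (t : ℝ) : ‖primitive g t‖ ≤ √l * ‖g‖ :=
  (intervalIntegral.norm_integral_le_integral_norm_uIoc.trans
    (setIntegral_le_integral (integrable_extendByZero g).norm
      (Filter.Eventually.of_forall fun _ => norm_nonneg _))).trans
    (integral_norm_extendByZero_le g)

/-- The map sending `g` to `t ↦ ∫₀ᵗ G φ`, where `G` is the primitive of `g`. -/
noncomputable def weightedPrimitive (φ : ℝ → 𝕜) (hφ : Continuous φ) :
    Lp 𝕜 2 (volume.restrict (Icc 0 l)) →ₗ[𝕜] (ℝ → 𝕜) where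
  toFun g t := ∫ s in 0..t, primitive g s * φ s
  map_add' f g := by
    funext t
    refine Eq.trans ?_ (intervalIntegral.integral_add
      (((continuous_primitive f).mul hφ).intervalIntegrable (μ := volume) 0 t)
      (((continuous_primitive g).mul hφ).intervalIntegrable (μ := volume) 0 t))
    simp [add_mul]
  map_smul' c g := by
    funext t
    rw [Pi.smul_apply, RingHom.id_apply, ← intervalIntegral.integral_smul]
    simp [mul_assoc]

theorem hasDerivAt_weightedPrimitive {φ : ℝ → 𝕜} (hφ : Continuous φ) (t : ℝ) :
    HasDerivAt (weightedPrimitive φ hφ g) (primitive g t * φ t) t :=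
  intervalIntegral.integral_hasDerivAt_right
    (((continuous_primitive g).mul hφ).intervalIntegrable _ _)
    ((continuous_primitive g).mul hφ).stronglyMeasurable.stronglyMeasurableAtFilter
    ((continuous_primitive g).mul hφ).continuousAt

theorem exists_norm_weightedPrimitive_le (l : ℝ) {φ : ℝ → 𝕜} (hφ : Continuous φ) :
    ∃ K : ℝ, 0 ≤ K ∧ ∀ g : Lp 𝕜 2 (volume.restrict (Icc 0 l)), ∀ t ∈ Icc 0 l,
      ‖weightedPrimitive φ hφ g t‖ ≤ K * ‖g‖ := by
  obtain ⟨B, hB⟩ := isCompact_Icc.exists_bound_of_continuousOn (hφ.continuousOn (s := Icc 0 l))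
  by_cases hl : 0 ≤ l
  · have hB0 : 0 ≤ B := (norm_nonneg _).trans (hB 0 (left_mem_Icc.2 hl))
    refine ⟨√l * B * l, by positivity, fun g t ht => ?_⟩
    have := intervalIntegral.norm_integral_le_of_norm_le_const (a := 0) (b := t)
      (f := fun s => primitive g s * φ s) (C := √l * ‖g‖ * B) fun s hs => by
        rw [uIoc_of_le ht.1] at hs
        rw [norm_mul]
        exact mul_le_mul (norm_primitive_le g s) (hB s ⟨hs.1.le, hs.2.trans ht.2⟩)
          (norm_nonneg _) (by positivity)
    refine this.trans ?_
    rw [sub_zero, abs_of_nonneg ht.1]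
    calc √l * ‖g‖ * B * t ≤ √l * ‖g‖ * B * l := by gcongr; exact ht.2
      _ = _ := by ring
  · exact ⟨0, le_rfl, fun g t ht => absurd (ht.1.trans ht.2) hl⟩

/-- A bounded solution operator `g ↦ (u, u')` of the initial value problem
`-u'' = z u + g`, `u 0 = u' 0 = 0`. -/
theorem exists_particular_solution (z : 𝕜) (l : ℝ) :
    ∃ (U W : Lp 𝕜 2 (volume.restrict (Icc 0 l)) →ₗ[𝕜] (ℝ → 𝕜)) (K : ℝ), 0 ≤ K ∧ ∀ g,
      (∀ t ∈ Icc 0 l, ‖U g t‖ ≤ K * ‖g‖ ∧ ‖W g t‖ ≤ K * ‖g‖) ∧ U g 0 = 0 ∧ W g 0 = 0 ∧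
      (∀ t, HasDerivAt (U g) (W g t) t) ∧ Continuous (W g) ∧
      ∀ t ∈ Icc 0 l, W g t = ∫ s in 0..t, (-(z * U g s) - g s) := by
  obtain ⟨C, S, h⟩ := IsFundamentalPair.exists_pair z
  obtain ⟨K₁, hK₁, hK₁'⟩ := exists_norm_weightedPrimitive_le l h.continuous_C
  obtain ⟨K₂, hK₂, hK₂'⟩ := exists_norm_weightedPrimitive_le l h.continuous_S
  obtain ⟨B₁, hB₁⟩ := isCompact_Icc.exists_bound_of_continuousOn
    (h.continuous_C.continuousOn (s := Icc 0 l))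
  obtain ⟨B₂, hB₂⟩ := isCompact_Icc.exists_bound_of_continuousOn
    (h.continuous_S.continuousOn (s := Icc 0 l))
  -- Variation of constants in a form that sees only the primitive `G` of `g`. With `w = U' + G` the
  -- system is `U' = w - G`, `w' = -z U`. Writing `U = C p + S q` and `w = -z S p + C q`, the
  -- Wronskian identity gives `p' = -C G` and `q' = -z S G`. All these functions are differentiable
  -- everywhere; the roughness of `g` enters only through `W = w - G`.
  let p := -weightedPrimitive (l := l) C h.continuous_C
  let q := -(z • weightedPrimitive (l := l) S h.continuous_S)
  have hp : ∀ g t, HasDerivAt (p g) (-(primitive g t * C t)) t := fun g t =>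
    (hasDerivAt_weightedPrimitive g h.continuous_C t).neg
  have hq : ∀ g t, HasDerivAt (q g) (-(z * (primitive g t * S t))) t := fun g t =>
    ((hasDerivAt_weightedPrimitive g h.continuous_S t).const_mul z).neg
  have hp0 : ∀ g, p g 0 = 0 := fun g => by simp [p, weightedPrimitive]
  have hq0 : ∀ g, q g 0 = 0 := fun g => by simp [q, weightedPrimitive]
  have hpK : ∀ g, ∀ t ∈ Icc 0 l, ‖p g t‖ ≤ K₁ * ‖g‖ := fun g t ht => by
    simpa [p] using hK₁' g t ht
  have hqK : ∀ g, ∀ t ∈ Icc 0 l, ‖q g t‖ ≤ ‖z‖ * K₂ * ‖g‖ := fun g t ht => by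
    have : ‖q g t‖ = ‖z‖ * ‖weightedPrimitive S h.continuous_S g t‖ := by simp [q]
    rw [this, mul_assoc]
    exact mul_le_mul_of_nonneg_left (hK₂' g t ht) (norm_nonneg _)
  let U : Lp 𝕜 2 (volume.restrict (Icc 0 l)) →ₗ[𝕜] (ℝ → 𝕜) :=
    (LinearMap.mulLeft 𝕜 C) ∘ₗ p + (LinearMap.mulLeft 𝕜 S) ∘ₗ q
  let w : Lp 𝕜 2 (volume.restrict (Icc 0 l)) →ₗ[𝕜] (ℝ → 𝕜) :=
    -(z • (LinearMap.mulLeft 𝕜 S) ∘ₗ p) + (LinearMap.mulLeft 𝕜 C) ∘ₗ q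
  let W : Lp 𝕜 2 (volume.restrict (Icc 0 l)) →ₗ[𝕜] (ℝ → 𝕜) := w - primitive
  have hU : ∀ g t, U g t = C t * p g t + S t * q g t := fun g t => rfl
  have hw : ∀ g t, w g t = -(z * (S t * p g t)) + C t * q g t := fun g t => rfl
  have hW : ∀ g t, W g t = w g t - primitive g t := fun g t => rfl
  have dU : ∀ g t, HasDerivAt (U g) (W g t) t := fun g t => by
    convert! ((h.hasDerivAt_C t).mul (hp g t)).add ((h.hasDerivAt_S t).mul (hq g t)) using 1
    rw [hW, hw]
    linear_combination primitive g t * h.wronskian t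
  have dw : ∀ g t, HasDerivAt (w g) (-(z * U g t)) t := fun g t => by
    convert! ((((h.hasDerivAt_S t).mul (hp g t)).const_mul z).neg).add
      ((h.hasDerivAt_C t).mul (hq g t)) using 1
    rw [hU]
    ring
  have w0 : ∀ g, w g 0 = 0 := fun g => by simp [hw, hp0, hq0]
  have g0 : ∀ g : Lp 𝕜 2 (volume.restrict (Icc 0 l)), primitive g 0 = 0 := fun g => by
    simp [primitive]
  have cU : ∀ g, Continuous (U g) := fun g =>
    continuous_iff_continuousAt.2 fun t => (dU g t).continuousAt
  have cw : ∀ g, Continuous (w g) := fun g =>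
    continuous_iff_continuousAt.2 fun t => (dw g t).continuousAt
  refine ⟨U, W, (|B₁| * K₁ + |B₂| * (‖z‖ * K₂)) +
      (‖z‖ * (|B₂| * K₁) + |B₁| * (‖z‖ * K₂) + √l), by positivity, fun g =>
    ⟨fun t ht => ?_, by simp [hU, hp0, hq0], by simp [hW, w0, g0], dU g,
      (cw g).sub (continuous_primitive g), fun t ht => ?_⟩⟩
  · have b1 : ‖C t‖ ≤ |B₁| := (hB₁ t ht).trans (le_abs_self _)
    have b2 : ‖S t‖ ≤ |B₂| := (hB₂ t ht).trans (le_abs_self _)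
    have e1 : ‖U g t‖ ≤ |B₁| * (K₁ * ‖g‖) + |B₂| * (‖z‖ * K₂ * ‖g‖) := by
      rw [hU]
      refine (norm_add_le _ _).trans ?_
      rw [norm_mul, norm_mul]
      gcongr
      exacts [hpK g t ht, hqK g t ht]
    have e2 : ‖W g t‖ ≤
        ‖z‖ * (|B₂| * (K₁ * ‖g‖)) + |B₁| * (‖z‖ * K₂ * ‖g‖) + √l * ‖g‖ := by
      rw [hW, hw]
      refine (norm_sub_le _ _).trans (add_le_add ((norm_add_le _ _).trans ?_)
        (norm_primitive_le g t))
      rw [norm_neg, norm_mul, norm_mul, norm_mul]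
      gcongr
      exacts [hpK g t ht, hqK g t ht]
    have n1 : 0 ≤ |B₁| * (K₁ * ‖g‖) + |B₂| * (‖z‖ * K₂ * ‖g‖) := by positivity
    have n2 : 0 ≤ ‖z‖ * (|B₂| * (K₁ * ‖g‖)) + |B₁| * (‖z‖ * K₂ * ‖g‖) + √l * ‖g‖ := by
      positivity
    constructor
    · linarith
    · linarith
  · have e1 : w g t = ∫ s in 0..t, -(z * U g s) := by
      rw [intervalIntegral.integral_eq_sub_of_hasDerivAt (fun s _ => dw g s)
        ((((cU g).const_mul z).neg).intervalIntegrable _ _), w0, sub_zero]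
    have e2 : primitive g t = ∫ s in 0..t, g s := by
      refine intervalIntegral.integral_congr fun s hs => ?_
      rw [uIcc_of_le ht.1] at hs
      exact indicator_of_mem (show s ∈ Icc 0 l from ⟨hs.1, hs.2.trans ht.2⟩) _
    rw [hW, e1, e2]
    refine (intervalIntegral.integral_sub
      ((((cU g).const_mul z).neg).intervalIntegrable (μ := volume) 0 t) ?_).symm
    rw [intervalIntegrable_iff_integrableOn_Icc_of_le ht.1]
    exact IntegrableOn.mono_set (integrable_coe g) (Icc_subset_Icc_right ht.2)

end Particular

namespace MetricGraph

variable {V E : Type*} {M : MetricGraph V E} {𝕜 : Type*} [RCLike 𝕜]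

/-! ### Representatives -/

instance isFiniteMeasure_edgeMeasure (e : E) : IsFiniteMeasure (M.edgeMeasure e) := by
  unfold edgeMeasure
  infer_instance

theorem zero_mem_edge (M : MetricGraph V E) (e : E) : (0 : ℝ) ∈ Icc 0 (M.length e) :=
  left_mem_Icc.2 (M.length_pos e).le

theorem length_mem_edge (M : MetricGraph V E) (e : E) : M.length e ∈ Icc 0 (M.length e) :=
  right_mem_Icc.2 (M.length_pos e).le

theorem memLp_edgeMeasure_of_continuousOn {φ : ℝ → 𝕜} {e : E}
    (hφ : ContinuousOn φ (Icc 0 (M.length e))) : MemLp φ 2 (M.edgeMeasure e) := by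
  obtain ⟨B, hB⟩ := isCompact_Icc.exists_bound_of_continuousOn hφ
  exact MemLp.of_bound (hφ.aestronglyMeasurable measurableSet_Icc) B
    ((ae_restrict_iff' measurableSet_Icc).2 (Filter.Eventually.of_forall hB))

/-- Builds domain elements whose second derivative is known only as an `L²` function: the Lebesgue
differentiation theorem recovers `h` a.e. from its primitive. -/
theorem IsRep.of_integral {f : M.L2 𝕜} {u v h : E → ℝ → 𝕜}
    (hf : ∀ e, f e =ᵐ[M.edgeMeasure e] u e)
    (hu : ∀ e, ∀ t ∈ Icc 0 (M.length e),
      HasDerivWithinAt (u e) (v e t) (Icc 0 (M.length e)) t)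
    (hh : ∀ e, MemLp (h e) 2 (M.edgeMeasure e))
    (hv : ∀ e, ∀ t ∈ Icc 0 (M.length e), v e t = v e 0 + ∫ s in 0..t, h e s) :
    M.IsRep f u ∧ (∀ e, EqOn (M.edgeDeriv u e) (v e) (Icc 0 (M.length e))) ∧
      ∀ e, M.edgeDeriv (M.edgeDeriv u) e =ᵐ[M.edgeMeasure e] h e := by
  have h1 : ∀ e, EqOn (M.edgeDeriv u e) (v e) (Icc 0 (M.length e)) := fun e t ht =>
    (hu e t ht).derivWithin (uniqueDiffOn_edge e t ht)
  have hint : ∀ e, IntervalIntegrable (h e) volume 0 (M.length e) := fun e => by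
    rw [intervalIntegrable_iff_integrableOn_Icc_of_le (M.length_pos e).le]
    exact (hh e).integrable (by norm_num)
  have hac : ∀ e, AbsolutelyContinuousOnInterval (v e) 0 (M.length e) := fun e => by
    refine absCont_congr (M.length_pos e) (u := (fun _ => v e 0) + fun t => ∫ s in 0..t, h e s)
      (fun t ht => (hv e t ht).symm) ?_
    refine AbsolutelyContinuousOnInterval.add ?_
      ((hint e).absolutelyContinuousOnInterval_integral (M.length_pos e))
    exact absolutelyContinuousOnInterval_of_hasDerivWithinAt (f' := 0) (M.length_pos e)
      (fun t _ => hasDerivWithinAt_const _ _ _) continuousOn_const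
  have h2 : ∀ e, M.edgeDeriv (M.edgeDeriv u) e =ᵐ[M.edgeMeasure e] h e := fun e => by
    have hmem : ∀ᵐ x ∂(M.edgeMeasure e), x ∈ Icc 0 (M.length e) :=
      ae_restrict_mem measurableSet_Icc
    have hd : ∀ᵐ x ∂(M.edgeMeasure e), x ∈ uIcc 0 (M.length e) → ∀ c ∈ uIcc 0 (M.length e),
        HasDerivAt (fun x => ∫ s in c..x, h e s) (h e x) x :=
      ae_restrict_of_ae (hint e).ae_hasDerivAt_integral
    filter_upwards [hmem, hd] with x hx hdx
    rw [uIcc_of_le (M.length_pos e).le] at hdx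
    have hd' : HasDerivWithinAt (M.edgeDeriv u e) (h e x) (Icc 0 (M.length e)) x :=
      (((hdx hx 0 (M.zero_mem_edge e)).const_add (v e 0)).hasDerivWithinAt).congr
        (fun t ht => (h1 e ht).trans (hv e t ht)) ((h1 e hx).trans (hv e x hx))
    exact hd'.derivWithin (uniqueDiffOn_edge e x hx)
  refine ⟨⟨hf, fun e => ?_, fun e t ht => (hu e t ht).differentiableWithinAt, fun e =>
    absCont_congr (M.length_pos e) (h1 e).symm (hac e), fun e =>
    (hh e).ae_eq (h2 e).symm⟩, h1, h2⟩
  have hc := (hac e).continuousOn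
  rw [uIcc_of_le (M.length_pos e).le] at hc
  exact absolutelyContinuousOnInterval_of_hasDerivWithinAt (M.length_pos e) (hu e) hc

theorem IsRep.hasDerivWithinAt {f : M.L2 𝕜} {u : E → ℝ → 𝕜} (hu : M.IsRep f u) (e : E) {t : ℝ}
    (ht : t ∈ Icc 0 (M.length e)) :
    HasDerivWithinAt (u e) (M.edgeDeriv u e t) (Icc 0 (M.length e)) t :=
  (hu.differentiableOn e t ht).hasDerivWithinAt

/-- An a.e. solution is a classical one: `u' + z ∫ u` is absolutely continuous with derivative zero
a.e., hence constant, so `u'' = -z u` holds at every point and uniqueness applies. -/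
theorem IsRep.eq_fundamental {f : M.L2 𝕜} {u : E → ℝ → 𝕜} {z : 𝕜} {C S : ℝ → 𝕜}
    (hu : M.IsRep f u) (e : E)
    (hz : M.edgeDeriv (M.edgeDeriv u) e =ᵐ[M.edgeMeasure e] fun t => -(z * u e t))
    (h : IsFundamentalPair z C S) {t : ℝ} (ht : t ∈ Icc 0 (M.length e)) :
    u e t = u e 0 * C t + M.edgeDeriv u e 0 * S t ∧
      M.edgeDeriv u e t = u e 0 * -(z * S t) + M.edgeDeriv u e 0 * C t := by
  have hl := M.length_pos e
  set l := M.length e with hldef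
  -- Outside the edge `u e` is arbitrary; the extension by its endpoint values is continuous on `ℝ`.
  let w : ℝ → 𝕜 := IccExtend hl.le (domRestrict (Icc 0 l) (u e))
  have hwc : Continuous w := ((hu.differentiableOn e).continuousOn.domRestrict).Icc_extend'
  have hw : ∀ t ∈ Icc 0 l, w t = u e t := fun t ht => IccExtend_of_mem hl.le _ ht
  have hI : ∀ t, HasDerivAt (fun t => z * ∫ s in 0..t, w s) (z * w t) t := fun t =>
    (intervalIntegral.integral_hasDerivAt_right (hwc.intervalIntegrable _ _)
      hwc.stronglyMeasurable.stronglyMeasurableAtFilter hwc.continuousAt).const_mul z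
  have hac : AbsolutelyContinuousOnInterval
      (M.edgeDeriv u e + fun t => z * ∫ s in 0..t, w s) 0 l :=
    (hu.absCont_deriv e).add (absolutelyContinuousOnInterval_of_hasDerivWithinAt hl
      (fun t _ => (hI t).hasDerivWithinAt) (hwc.const_smul z).continuousOn)
  obtain ⟨c, hc⟩ := hac.const_of_ae_hasDerivAt_zero (by
    have h1 := (ae_restrict_iff' measurableSet_Icc).1 hz
    have h2 := (ae_restrict_iff' measurableSet_Icc).1
      (ae_differentiableWithinAt (hu.absCont_deriv e))
    -- Away from the two endpoints the one-sided derivatives are ordinary ones.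
    have h3 : ∀ᵐ x : ℝ, x ≠ 0 := by simp [ae_iff, measure_singleton]
    have h4 : ∀ᵐ x : ℝ, x ≠ l := by simp [ae_iff, measure_singleton]
    filter_upwards [h1, h2, h3, h4] with x h1 h2 h3 h4 hx
    rw [uIcc_of_le hl.le] at hx
    have hn : Icc 0 l ∈ nhds x := Icc_mem_nhds (lt_of_le_of_ne hx.1 h3.symm)
      (lt_of_le_of_ne hx.2 h4)
    have hd := (h2 hx).hasDerivWithinAt.hasDerivAt hn
    have e1 : derivWithin (M.edgeDeriv u e) (Icc 0 (M.length e)) x = -(z * u e x) := h1 hx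
    rw [e1] at hd
    convert! hd.add (hI x) using 1
    rw [hw x hx]
    ring)
  rw [uIcc_of_le hl.le] at hc
  have hv : ∀ t ∈ Icc 0 l, M.edgeDeriv u e t = c - z * ∫ s in 0..t, w s := fun t ht => by
    rw [← hc t ht]
    simp
  have hdv : ∀ t ∈ Icc 0 l, HasDerivWithinAt (M.edgeDeriv u e) (-(z * u e t)) (Icc 0 l) t :=
    fun t ht => by
      rw [← hw t ht]
      exact ((hI t).const_sub c).hasDerivWithinAt.congr hv (hv t ht)
  exact h.eq_of_hasDerivWithinAt (fun t ht => hu.hasDerivWithinAt e ht) hdv ht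

theorem IsRep.negSecondDeriv_ae_eq {f : M.L2 𝕜} {u : E → ℝ → 𝕜} (hu : M.IsRep f u) (e : E) :
    hu.negSecondDeriv e =ᵐ[M.edgeMeasure e] -M.edgeDeriv (M.edgeDeriv u) e :=
  (Lp.coeFn_neg _).trans (MemLp.coeFn_toLp (hu.memLp e)).neg

theorem ext_of_ae_eq {f g : M.L2 𝕜} (h : ∀ e, f e =ᵐ[M.edgeMeasure e] g e) : f = g := by
  ext1 e
  exact Lp.ext (h e)

/-! ### Domain and eigenspaces in terms of representatives -/

section Operator

variable [Fintype E]

theorem mem_domain_standardLaplacian {f : M.L2 𝕜} :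
    f ∈ (M.standardLaplacian 𝕜).domain ↔ ∃ u, M.IsRep f u ∧ M.IsStandard u :=
  ⟨fun h => h.1, fun h => ⟨h, h.imp fun _ hu => hu.1⟩⟩

theorem standardLaplacian_apply {f : M.L2 𝕜} (hf : f ∈ (M.standardLaplacian 𝕜).domain)
    {u : E → ℝ → 𝕜} (hu : M.IsRep f u) :
    M.standardLaplacian 𝕜 ⟨f, hf⟩ = hu.negSecondDeriv :=
  M.maxLaplacian_apply 𝕜 ⟨f, hf.2⟩ hu

theorem mem_eigenspace_iff {f : M.L2 𝕜} {z : 𝕜} :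
    f ∈ (M.standardLaplacian 𝕜).unboundedEigenspace z ↔
      ∃ u, M.IsRep f u ∧ M.IsStandard u ∧
        ∀ e, M.edgeDeriv (M.edgeDeriv u) e =ᵐ[M.edgeMeasure e] fun t => -(z * u e t) := by
  constructor
  · rintro ⟨hf, h⟩
    obtain ⟨u, hu, hs⟩ := mem_domain_standardLaplacian.1 hf
    refine ⟨u, hu, hs, fun e => ?_⟩
    rw [standardLaplacian_apply hf hu] at h
    have h1 := hu.negSecondDeriv_ae_eq e
    rw [h] at h1
    filter_upwards [h1, Lp.coeFn_smul z (f e), hu.ae_eq e] with t h1 h2 h3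
    have h4 : ((z • f) e : ℝ → 𝕜) t = z * f e t := h2
    rw [h4, h3, Pi.neg_apply] at h1
    rw [h1, neg_neg]
  · rintro ⟨u, hu, hs, h⟩
    refine ⟨mem_domain_standardLaplacian.2 ⟨u, hu, hs⟩, ?_⟩
    rw [standardLaplacian_apply _ hu]
    refine ext_of_ae_eq fun e => ?_
    filter_upwards [hu.negSecondDeriv_ae_eq e, Lp.coeFn_smul z (f e), hu.ae_eq e, h e]
      with t h1 h2 h3 h4
    have h5 : ((z • f) e : ℝ → 𝕜) t = z * f e t := h2
    rw [h1, h5, h3, Pi.neg_apply, h4, neg_neg]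

end Operator

/-! ### Combinatorics of the edges -/

theorem graph_adj {v w : V} : M.graph.Adj v w ↔ ∃ e, s(M.source e, M.target e) = s(v, w) := by
  unfold graph
  rw [SimpleGraph.fromEdgeSet_adj]
  constructor
  · exact fun h => h.1
  · rintro ⟨e, he⟩
    refine ⟨⟨e, he⟩, ?_⟩
    rintro rfl
    rw [Sym2.eq_iff] at he
    exact M.source_ne_target e (by rcases he with h | h <;> rw [h.1, h.2])

theorem adj_source_target (e : E) : M.graph.Adj (M.source e) (M.target e) :=
  graph_adj.2 ⟨e, rfl⟩

theorem graph_connected (M : MetricGraph V E) : M.graph.Connected := M.connected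

/-- Induction along a walk. The hypothesis is an equivalence because a walk may traverse an edge
against its orientation. -/
theorem vertex_induction (M : MetricGraph V E) {P : V → Prop}
    (h : ∀ e, P (M.source e) ↔ P (M.target e)) {v : V} (hv : P v) (w : V) : P w := by
  have hadj : ∀ a b, M.graph.Adj a b → P a → P b := fun a b hab ha => by
    obtain ⟨e, he⟩ := graph_adj.1 hab
    rcases Sym2.eq_iff.1 he with ⟨h1, h2⟩ | ⟨h1, h2⟩
    · rw [← h2, ← h, h1]
      exact ha
    · rw [← h1, h, h2]
      exact ha
  obtain ⟨p⟩ := M.graph_connected.preconnected v w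
  induction p with
  | nil => exact hv
  | cons hab _ ih => exact ih (hadj _ _ hab hv)

theorem exists_incident_edge [Nonempty E] (M : MetricGraph V E) (v : V) :
    ∃ e, v ∈ s(M.source e, M.target e) :=
  M.vertex_induction (P := fun v => ∃ e, v ∈ s(M.source e, M.target e))
    (fun e => iff_of_true ⟨e, by simp⟩ ⟨e, by simp⟩)
    (v := M.source (Classical.arbitrary E)) ⟨Classical.arbitrary E, by simp⟩ v

/-- The Kirchhoff sum at `v` of the derivatives `d₀` and `d₁` at the initial and final points of
the edges. -/
def kirchhoffSum [Fintype E] [DecidableEq V] (M : MetricGraph V E) (d₀ d₁ : E → 𝕜) (v : V) : 𝕜 :=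
  ∑ e, ((if v = M.source e then d₀ e else 0) - if v = M.target e then d₁ e else 0)

/-- Continuity is traded for a vertex function `c`, which later serves as an unknown of the linear
system. To define `c` from `u`, choose an incident edge at each vertex; one exists since the graph
is connected and has an edge. -/
theorem isStandard_iff [Fintype E] [DecidableEq V] [Nonempty E] {u : E → ℝ → 𝕜} :
    M.IsStandard u ↔ (∃ c : V → 𝕜, (∀ e, u e 0 = c (M.source e)) ∧
      (∀ e, u e (M.length e) = c (M.target e))) ∧
      M.kirchhoffSum (fun e => M.edgeDeriv u e 0) (fun e => M.edgeDeriv u e (M.length e)) = 0 := by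
  have hk : ∀ v, M.kirchhoffSum (fun e => M.edgeDeriv u e 0)
      (fun e => M.edgeDeriv u e (M.length e)) v = ∑ e, M.outDerivAt u v e := fun v => by
    refine Finset.sum_congr rfl fun e _ => ?_
    have := M.source_ne_target e
    unfold outDerivAt
    by_cases h1 : v = M.source e
    · subst h1
      simp [this]
    · by_cases h2 : v = M.target e <;> simp [h1, h2, this.symm]
  constructor
  · intro h
    refine ⟨?_, funext fun v => (hk v).trans (h.kirchhoff v)⟩
    choose ε hε using M.exists_incident_edge
    refine ⟨fun v => M.valueAt u v (ε v), fun e => ?_, fun e => ?_⟩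
    · change _ = M.valueAt u _ _
      rw [← h.continuous (M.source e) e (ε _) (by simp) (hε _)]
      simp [valueAt]
    · change _ = M.valueAt u _ _
      rw [← h.continuous (M.target e) e (ε _) (by simp) (hε _)]
      simp [valueAt, (M.source_ne_target e).symm]
  · rintro ⟨⟨c, h0, h1⟩, h2⟩
    have hval : ∀ v e, v ∈ s(M.source e, M.target e) → M.valueAt u v e = c v := fun v e he => by
      rcases Sym2.mem_iff.1 he with rfl | rfl
      · simp [valueAt, h0]
      · simp [valueAt, h1, (M.source_ne_target e).symm]
    exact ⟨fun v e e' he he' => (hval v e he).trans (hval v e' he').symm,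
      fun v => (hk v).symm.trans (congrFun h2 v)⟩

end MetricGraph

namespace MetricGraph

variable {V E : Type*} {M : MetricGraph V E} {𝕜 : Type*} [RCLike 𝕜]

/-! ### Solutions on the edges -/

/-- The functions `a C + b S` on the edges as elements of `L²(Γ)`. -/
noncomputable def fundamentalL2 (M : MetricGraph V E) {C S : ℝ → 𝕜} (hC : Continuous C)
    (hS : Continuous S) : ((E → 𝕜) × (E → 𝕜)) × (V → 𝕜) →ₗ[𝕜] M.L2 𝕜 where
  -- The component `x.2` is ignored; it is carried along so that the domain agrees with that of
  -- `vertexSystem`.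
  toFun x := WithLp.toLp 2 fun e =>
    x.1.1 e • (memLp_edgeMeasure_of_continuousOn (M := M) (e := e) hC.continuousOn).toLp C +
      x.1.2 e • (memLp_edgeMeasure_of_continuousOn (M := M) (e := e) hS.continuousOn).toLp S
  map_add' x y := by
    ext1 e
    simp only [Prod.fst_add, Prod.snd_add, Pi.add_apply, PiLp.add_apply, add_smul]
    abel
  map_smul' a x := by
    ext1 e
    simp only [Prod.smul_fst, Prod.smul_snd, Pi.smul_apply, PiLp.smul_apply, smul_eq_mul,
      RingHom.id_apply, mul_smul, smul_add]

theorem isRep_fundamentalL2 {z : 𝕜} {C S : ℝ → 𝕜} (h : IsFundamentalPair z C S)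
    (x : ((E → 𝕜) × (E → 𝕜)) × (V → 𝕜)) :
    M.IsRep (M.fundamentalL2 h.continuous_C h.continuous_S x)
      (fun e t => x.1.1 e * C t + x.1.2 e * S t) ∧
    (∀ e, EqOn (M.edgeDeriv (fun e t => x.1.1 e * C t + x.1.2 e * S t) e)
      (fun t => x.1.1 e * -(z * S t) + x.1.2 e * C t) (Icc 0 (M.length e))) ∧
    ∀ e, M.edgeDeriv (M.edgeDeriv fun e t => x.1.1 e * C t + x.1.2 e * S t) e
      =ᵐ[M.edgeMeasure e] fun t => -(z * (x.1.1 e * C t + x.1.2 e * S t)) := by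
  have hc := h.continuous_C
  have hs := h.continuous_S
  refine IsRep.of_integral (fun e => ?_) (fun e t _ => ?_) (fun e => ?_) (fun e t _ => ?_)
  · refine (Lp.coeFn_add _ _).trans (Filter.EventuallyEq.add ?_ ?_)
    · filter_upwards [Lp.coeFn_smul (x.1.1 e) ((memLp_edgeMeasure_of_continuousOn (M := M)
        (e := e) hc.continuousOn).toLp C), MemLp.coeFn_toLp (memLp_edgeMeasure_of_continuousOn
        (M := M) (e := e) hc.continuousOn)] with t h1 h2
      rw [h1, Pi.smul_apply, h2, smul_eq_mul]
    · filter_upwards [Lp.coeFn_smul (x.1.2 e) ((memLp_edgeMeasure_of_continuousOn (M := M)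
        (e := e) hs.continuousOn).toLp S), MemLp.coeFn_toLp (memLp_edgeMeasure_of_continuousOn
        (M := M) (e := e) hs.continuousOn)] with t h1 h2
      rw [h1, Pi.smul_apply, h2, smul_eq_mul]
  · exact (((h.hasDerivAt_C t).const_mul _).add
      ((h.hasDerivAt_S t).const_mul _)).hasDerivWithinAt
  · exact memLp_edgeMeasure_of_continuousOn (by fun_prop)
  · have hd : ∀ t, HasDerivAt (fun t => x.1.1 e * -(z * S t) + x.1.2 e * C t)
        (-(z * (x.1.1 e * C t + x.1.2 e * S t))) t := fun t => by
      convert! ((((h.hasDerivAt_S t).const_mul z).neg).const_mul (x.1.1 e)).add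
        ((h.hasDerivAt_C t).const_mul (x.1.2 e)) using 1
      ring
    rw [intervalIntegral.integral_eq_sub_of_hasDerivAt (fun s _ => hd s)
      (Continuous.intervalIntegrable (by fun_prop) _ _)]
    ring

/-! ### The linear system for the vertex conditions -/

section System

variable [Fintype E] [DecidableEq V]

/-- `kirchhoffSum` as a linear map. -/
def kirchhoffMap (M : MetricGraph V E) (𝕜 : Type*) [RCLike 𝕜] :
    (E → 𝕜) × (E → 𝕜) →ₗ[𝕜] (V → 𝕜) where
  toFun d := M.kirchhoffSum d.1 d.2
  map_add' d d' := by
    funext v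
    simp only [kirchhoffSum, Pi.add_apply, Prod.fst_add, Prod.snd_add,
      ← Finset.sum_add_distrib]
    refine Finset.sum_congr rfl fun e _ => ?_
    split_ifs <;> ring
  map_smul' a d := by
    funext v
    simp only [kirchhoffSum, Pi.smul_apply, Prod.smul_fst, Prod.smul_snd, smul_eq_mul,
      RingHom.id_apply, Finset.mul_sum]
    refine Finset.sum_congr rfl fun e _ => ?_
    split_ifs <;> ring

/-- The final values on the edges of the solutions with initial data `(a, b)`. -/
def finalValue (M : MetricGraph V E) (C S : ℝ → 𝕜) : (E → 𝕜) × (E → 𝕜) →ₗ[𝕜] (E → 𝕜) where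
  toFun x e := x.1 e * C (M.length e) + x.2 e * S (M.length e)
  map_add' x y := by
    funext e
    simp only [Prod.fst_add, Prod.snd_add, Pi.add_apply]
    ring
  map_smul' a x := by
    funext e
    simp only [Prod.smul_fst, Prod.smul_snd, Pi.smul_apply, smul_eq_mul, RingHom.id_apply]
    ring

/-- The linear system for the initial data `a`, `b` along the edges and the vertex values `c` which
expresses the standard vertex conditions for `a C + b S`. -/
def vertexSystem (M : MetricGraph V E) (z : 𝕜) (C S : ℝ → 𝕜) :
    ((E → 𝕜) × (E → 𝕜)) × (V → 𝕜) →ₗ[𝕜] ((E → 𝕜) × (E → 𝕜)) × (V → 𝕜) :=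
  let ab := LinearMap.fst 𝕜 ((E → 𝕜) × (E → 𝕜)) (V → 𝕜)
  let c := LinearMap.snd 𝕜 ((E → 𝕜) × (E → 𝕜)) (V → 𝕜)
  let a := LinearMap.fst 𝕜 (E → 𝕜) (E → 𝕜) ∘ₗ ab
  let b := LinearMap.snd 𝕜 (E → 𝕜) (E → 𝕜) ∘ₗ ab
  ((a - LinearMap.funLeft 𝕜 𝕜 M.source ∘ₗ c).prod
      (M.finalValue C S ∘ₗ ab - LinearMap.funLeft 𝕜 𝕜 M.target ∘ₗ c)).prod
    (M.kirchhoffMap 𝕜 ∘ₗ b.prod (M.finalValue (fun t => -(z * S t)) C ∘ₗ ab))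

theorem vertexSystem_eq_iff {z : 𝕜} {C S : ℝ → 𝕜} {x y : ((E → 𝕜) × (E → 𝕜)) × (V → 𝕜)} :
    M.vertexSystem z C S x = y ↔
      (∀ e, x.1.1 e - x.2 (M.source e) = y.1.1 e) ∧
      (∀ e, x.1.1 e * C (M.length e) + x.1.2 e * S (M.length e) - x.2 (M.target e) = y.1.2 e) ∧
      M.kirchhoffSum x.1.2
        (fun e => x.1.1 e * -(z * S (M.length e)) + x.1.2 e * C (M.length e)) = y.2 := by
  rw [Prod.ext_iff, Prod.ext_iff, and_assoc, funext_iff, funext_iff]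
  rfl

theorem mem_ker_vertexSystem {z : 𝕜} {C S : ℝ → 𝕜} {x : ((E → 𝕜) × (E → 𝕜)) × (V → 𝕜)} :
    x ∈ LinearMap.ker (M.vertexSystem z C S) ↔
      (∀ e, x.1.1 e = x.2 (M.source e)) ∧
      (∀ e, x.1.1 e * C (M.length e) + x.1.2 e * S (M.length e) = x.2 (M.target e)) ∧
      M.kirchhoffSum x.1.2
        (fun e => x.1.1 e * -(z * S (M.length e)) + x.1.2 e * C (M.length e)) = 0 := by
  rw [LinearMap.mem_ker, vertexSystem_eq_iff]
  simp [sub_eq_zero]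

/-- By `IsRep.eq_fundamental` an eigenfunction is `a C + b S` on each edge with `a = u 0` and `b =
u' 0`; the vertex conditions then read off as the linear system. -/
theorem eigenspace_eq_map [Nonempty E] {z : 𝕜} {C S : ℝ → 𝕜} (h : IsFundamentalPair z C S) :
    (M.standardLaplacian 𝕜).unboundedEigenspace z =
      (LinearMap.ker (M.vertexSystem z C S)).map
        (M.fundamentalL2 h.continuous_C h.continuous_S) := by
  ext f
  rw [mem_eigenspace_iff, Submodule.mem_map]
  constructor
  · rintro ⟨u, hu, hs, hz⟩
    obtain ⟨⟨c, h0, h1⟩, h2⟩ := isStandard_iff.1 hs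
    have hu' := fun e {t} ht => hu.eq_fundamental e (hz e) h (t := t) ht
    refine ⟨((fun e => u e 0, fun e => M.edgeDeriv u e 0), c), ?_, ?_⟩
    · refine mem_ker_vertexSystem.2 ⟨h0, fun e => ?_, ?_⟩
      · exact (hu' e (M.length_mem_edge e)).1.symm.trans (h1 e)
      · rw [← h2]
        congr 1
        funext e
        rw [(hu' e (M.length_mem_edge e)).2]
    · refine ext_of_ae_eq fun e => ?_
      have hmem : ∀ᵐ x ∂(M.edgeMeasure e), x ∈ Icc 0 (M.length e) :=
        ae_restrict_mem measurableSet_Icc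
      filter_upwards [(isRep_fundamentalL2 (M := M) h
        ((fun e => u e 0, fun e => M.edgeDeriv u e 0), c)).1.ae_eq e, hu.ae_eq e, hmem]
        with t e1 e2 ht
      rw [e1, e2, (hu' e ht).1]
  · rintro ⟨x, hx, rfl⟩
    obtain ⟨h0, h1, h2⟩ := mem_ker_vertexSystem.1 hx
    obtain ⟨r1, r2, r3⟩ := isRep_fundamentalL2 (M := M) h x
    refine ⟨_, r1, isStandard_iff.2 ⟨⟨x.2, fun e => ?_, h1⟩, ?_⟩, r3⟩
    · simp [h.C_zero, h.S_zero, h0]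
    · rw [← h2]
      congr 1
      · funext e
        rw [r2 e (M.zero_mem_edge e)]
        simp [h.C_zero, h.S_zero]
      · funext e
        exact r2 e (M.length_mem_edge e)

/-- The function determines `a` and `b` by its data at `0`. Membership in the kernel is needed to
recover `c`, through an edge at each vertex. -/
theorem eq_zero_of_fundamentalL2_eq_zero [Nonempty E] {z : 𝕜} {C S : ℝ → 𝕜}
    (h : IsFundamentalPair z C S) {x : ((E → 𝕜) × (E → 𝕜)) × (V → 𝕜)}
    (hx : x ∈ LinearMap.ker (M.vertexSystem z C S))
    (h0 : M.fundamentalL2 h.continuous_C h.continuous_S x = 0) : x = 0 := by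
  obtain ⟨r1, r2, r3⟩ := isRep_fundamentalL2 (M := M) h x
  rw [h0] at r1
  have hu := r1.eqOn IsRep.zero
  have ha : x.1.1 = 0 := funext fun e => by
    simpa [h.C_zero, h.S_zero] using hu e (M.zero_mem_edge e)
  have hb : x.1.2 = 0 := funext fun e => by
    have h1 := edgeDeriv_congr (M := M) (u := fun e t => x.1.1 e * C t + x.1.2 e * S t) (v := 0)
      (hu e) (M.zero_mem_edge e)
    rw [r2 e (M.zero_mem_edge e)] at h1
    have h2 : M.edgeDeriv (0 : E → ℝ → 𝕜) e 0 = 0 :=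
      (hasDerivWithinAt_const (0 : ℝ) (Icc 0 (M.length e)) (0 : 𝕜)).derivWithin
        (uniqueDiffOn_edge e 0 (M.zero_mem_edge e))
    simpa [h.C_zero, h.S_zero, h2] using h1
  obtain ⟨k0, k1, -⟩ := mem_ker_vertexSystem.1 hx
  refine Prod.ext (Prod.ext ha hb) (funext fun v => ?_)
  obtain ⟨e, he⟩ := M.exists_incident_edge v
  rcases Sym2.mem_iff.1 he with rfl | rfl
  · rw [← k0, ha]
    rfl
  · rw [← k1, ha, hb]
    simp

/-- The eigenspaces are given by the solutions of `vertexSystem`. -/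
noncomputable def kerEquivEigenspace [Nonempty E] {z : 𝕜} {C S : ℝ → 𝕜}
    (h : IsFundamentalPair z C S) : LinearMap.ker (M.vertexSystem z C S) ≃ₗ[𝕜]
      (M.standardLaplacian 𝕜).unboundedEigenspace z :=
  (LinearEquiv.ofInjective ((M.fundamentalL2 h.continuous_C h.continuous_S).domRestrict
    (LinearMap.ker (M.vertexSystem z C S))) (by
      rw [← LinearMap.ker_eq_bot, LinearMap.ker_eq_bot']
      exact fun x hx => Subtype.ext (eq_zero_of_fundamentalL2_eq_zero h x.2 hx))).trans
    (LinearEquiv.ofEq _ _ (by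
      rw [eigenspace_eq_map h, LinearMap.range_domRestrict]))

theorem finiteDimensional_eigenspace [Nonempty E] [Fintype V] (z : 𝕜) :
    FiniteDimensional 𝕜 ((M.standardLaplacian 𝕜).unboundedEigenspace z) := by
  obtain ⟨C, S, h⟩ := IsFundamentalPair.exists_pair z
  exact (kerEquivEigenspace (M := M) h).finiteDimensional

end System

/-! ### The resolvent -/

/-- Solves the equation on each edge separately with zero initial data. The functionals `β` and `γ`
record the values and derivatives at the final points, by which the vertex conditions fail; their
continuity makes the corrected resolvent bounded. -/
theorem exists_particular_solution_operator (M : MetricGraph V E) (z : 𝕜) :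
    ∃ (P : M.L2 𝕜 →L[𝕜] M.L2 𝕜) (β γ : M.L2 𝕜 →L[𝕜] (E → 𝕜)), ∀ g, ∃ u, M.IsRep (P g) u ∧
      (∀ e, u e 0 = 0) ∧ (∀ e, u e (M.length e) = β g e) ∧ (∀ e, M.edgeDeriv u e 0 = 0) ∧
      (∀ e, M.edgeDeriv u e (M.length e) = γ g e) ∧
      ∀ e, M.edgeDeriv (M.edgeDeriv u) e =ᵐ[M.edgeMeasure e] fun t => -(z * u e t) - g e t := by
  have H : ∀ e, ∃ (U W : Lp 𝕜 2 (M.edgeMeasure e) →ₗ[𝕜] (ℝ → 𝕜)) (K : ℝ), 0 ≤ K ∧ ∀ g,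
      (∀ t ∈ Icc 0 (M.length e), ‖U g t‖ ≤ K * ‖g‖ ∧ ‖W g t‖ ≤ K * ‖g‖) ∧ U g 0 = 0 ∧ W g 0 = 0 ∧
      (∀ t, HasDerivAt (U g) (W g t) t) ∧ Continuous (W g) ∧
      ∀ t ∈ Icc 0 (M.length e), W g t = ∫ s in 0..t, (-(z * U g s) - g s) :=
    fun e => exists_particular_solution z (M.length e)
  choose U W K hK0 hK hU0 hW0 hU hWc hW using H
  have hUc : ∀ e g, Continuous (U e g) := fun e g =>
    continuous_iff_continuousAt.2 fun t => (hU e g t).continuousAt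
  have hUm : ∀ e g, MemLp (U e g) 2 (M.edgeMeasure e) := fun e g =>
    memLp_edgeMeasure_of_continuousOn (hUc e g).continuousOn
  let P₁ : ∀ e, Lp 𝕜 2 (M.edgeMeasure e) →L[𝕜] Lp 𝕜 2 (M.edgeMeasure e) := fun e =>
    LinearMap.mkContinuous
      { toFun := fun g => (hUm e g).toLp _
        map_add' := fun f g => by
          rw [← MemLp.toLp_add]
          exact MemLp.toLp_congr _ _ (by rw [map_add])
        map_smul' := fun a g => by
          rw [RingHom.id_apply, ← MemLp.toLp_const_smul]
          exact MemLp.toLp_congr _ _ (by rw [map_smul]) }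
      -- The `L²` norm is at most the square root of the edge length times the sup bound `K e *
      -- ‖g‖`.
      ((measureUnivNNReal (M.edgeMeasure e) : ℝ) ^ (ENNReal.toReal 2)⁻¹ * K e) (fun g => by
        rw [mul_assoc]
        refine Lp.norm_le_of_ae_bound (mul_nonneg (hK0 e) (norm_nonneg _)) ?_
        have hmem : ∀ᵐ x ∂(M.edgeMeasure e), x ∈ Icc 0 (M.length e) :=
          ae_restrict_mem measurableSet_Icc
        filter_upwards [MemLp.coeFn_toLp (hUm e g), hmem] with t h1 ht
        change ‖((hUm e g).toLp _ : ℝ → 𝕜) t‖ ≤ _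
        rw [h1]
        exact (hK e g t ht).1)
  let β₁ : ∀ e, Lp 𝕜 2 (M.edgeMeasure e) →L[𝕜] 𝕜 := fun e =>
    LinearMap.mkContinuous (LinearMap.proj (M.length e) ∘ₗ U e) (K e) fun g =>
      (hK e g _ (M.length_mem_edge e)).1
  let γ₁ : ∀ e, Lp 𝕜 2 (M.edgeMeasure e) →L[𝕜] 𝕜 := fun e =>
    LinearMap.mkContinuous (LinearMap.proj (M.length e) ∘ₗ W e) (K e) fun g =>
      (hK e g _ (M.length_mem_edge e)).2
  let pr : ∀ e, M.L2 𝕜 →L[𝕜] Lp 𝕜 2 (M.edgeMeasure e) := fun e => PiLp.proj 2 _ e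
  refine ⟨((PiLp.continuousLinearEquiv 2 𝕜 fun e => Lp 𝕜 2 (M.edgeMeasure e)).symm :
      (∀ e, Lp 𝕜 2 (M.edgeMeasure e)) →L[𝕜] M.L2 𝕜) ∘L
      ContinuousLinearMap.pi fun e => P₁ e ∘L pr e,
    ContinuousLinearMap.pi fun e => β₁ e ∘L pr e, ContinuousLinearMap.pi fun e => γ₁ e ∘L pr e,
    fun g => ⟨fun e => U e (g e), ?_⟩⟩
  obtain ⟨r1, r2, r3⟩ := IsRep.of_integral (M := M)
    (f := ((PiLp.continuousLinearEquiv 2 𝕜 fun e => Lp 𝕜 2 (M.edgeMeasure e)).symm :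
      (∀ e, Lp 𝕜 2 (M.edgeMeasure e)) →L[𝕜] M.L2 𝕜)
      (ContinuousLinearMap.pi (fun e => P₁ e ∘L pr e) g))
    (u := fun e => U e (g e)) (v := fun e => W e (g e))
    (h := fun e t => -(z * U e (g e) t) - g e t)
    (fun e => MemLp.coeFn_toLp (hUm e (g e))) (fun e t _ => (hU e (g e) t).hasDerivWithinAt)
    (fun e => (((hUm e (g e)).const_mul z).neg).sub (Lp.memLp (g e)))
    (fun e t ht => by rw [hW0, zero_add, hW e (g e) t ht])
  exact ⟨r1, fun e => hU0 e _, fun e => rfl, fun e => (r2 e (M.zero_mem_edge e)).trans (hW0 e _),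
    fun e => r2 e (M.length_mem_edge e), r3⟩

section Resolvent

variable [Fintype E] [Fintype V] [DecidableEq V]

/-- The resolvent is `P` plus a finite-rank correction by solutions of the homogeneous equation,
chosen to restore the vertex conditions. -/
theorem mem_resolventSet_of_eigenspace_eq_bot [Nonempty E] {z : 𝕜}
    (hz : (M.standardLaplacian 𝕜).unboundedEigenspace z = ⊥) :
    z ∈ (M.standardLaplacian 𝕜).unboundedResolventSet := by
  obtain ⟨C, S, h⟩ := IsFundamentalPair.exists_pair z
  obtain ⟨P, β, γ, hP⟩ := M.exists_particular_solution_operator z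
  have hinj : Function.Injective (M.vertexSystem z C S) := by
    rw [← LinearMap.ker_eq_bot, LinearMap.ker_eq_bot']
    intro x hx
    refine eq_zero_of_fundamentalL2_eq_zero h hx ?_
    rw [← Submodule.mem_bot 𝕜, ← hz, eigenspace_eq_map h]
    exact Submodule.mem_map_of_mem hx
  -- Domain and codomain coincide and are finite-dimensional, so injectivity gives invertibility.
  let L := LinearEquiv.ofInjectiveEndo (M.vertexSystem z C S) hinj
  have hL : ∀ y, M.vertexSystem z C S (L.symm y) = y := fun y => L.apply_symm_apply y
  -- Minus the defect of `P g` in the vertex conditions. The initial data of `P g` vanish, so only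
  -- `β g` and `γ g` contribute.
  let D : M.L2 𝕜 →L[𝕜] ((E → 𝕜) × (E → 𝕜)) × (V → 𝕜) :=
    ((0 : M.L2 𝕜 →L[𝕜] (E → 𝕜)).prod (-β)).prod
      (-((LinearMap.toContinuousLinearMap (M.kirchhoffMap 𝕜)) ∘L
        ((0 : M.L2 𝕜 →L[𝕜] (E → 𝕜)).prod γ)))
  let R : M.L2 𝕜 →L[𝕜] M.L2 𝕜 := P +
    (LinearMap.toContinuousLinearMap (M.fundamentalL2 h.continuous_C h.continuous_S)) ∘L
      ((LinearMap.toContinuousLinearMap (L.symm : _ →ₗ[𝕜] _)) ∘L D)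
  have hR : ∀ g, ∃ hg : R g ∈ (M.standardLaplacian 𝕜).domain,
      M.standardLaplacian 𝕜 ⟨R g, hg⟩ - z • R g = g := fun g => by
    obtain ⟨u, hu, u0, ul, d0, dl, hd⟩ := hP g
    let x := L.symm (D g)
    obtain ⟨k0, k1, k2⟩ := vertexSystem_eq_iff.1 (hL (D g))
    change ∀ e, x.1.1 e - x.2 (M.source e) = 0 at k0
    change ∀ e, x.1.1 e * C (M.length e) + x.1.2 e * S (M.length e) - x.2 (M.target e) =
      -β g e at k1
    change M.kirchhoffMap 𝕜 (x.1.2,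
        (fun e => x.1.1 e * -(z * S (M.length e)) + x.1.2 e * C (M.length e))) =
      -M.kirchhoffMap 𝕜 (0, γ g) at k2
    obtain ⟨r1, r2, r3⟩ := isRep_fundamentalL2 (M := M) h x
    have hr := hu.add r1
    have hrd := hu.edgeDeriv_add_eqOn r1
    have hmem : R g ∈ (M.standardLaplacian 𝕜).domain := by
      refine mem_domain_standardLaplacian.2 ⟨_, hr, isStandard_iff.2
        ⟨⟨x.2, fun e => ?_, fun e => ?_⟩, ?_⟩⟩
      · simp only [Pi.add_apply, u0, h.C_zero, h.S_zero]
        linear_combination k0 e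
      · simp only [Pi.add_apply, ul]
        linear_combination k1 e
      · have k3 : M.kirchhoffMap 𝕜 ((x.1.2,
            (fun e => x.1.1 e * -(z * S (M.length e)) + x.1.2 e * C (M.length e))) +
            (0, γ g)) = 0 := by
          rw [map_add, k2, neg_add_cancel]
        rw [← k3]
        change _ = M.kirchhoffSum (x.1.2 + 0) (_ + γ g)
        congr 1
        · funext e
          rw [hrd e (M.zero_mem_edge e), Pi.add_apply, d0, r2 e (M.zero_mem_edge e)]
          simp [h.C_zero, h.S_zero]
        · funext e
          rw [hrd e (M.length_mem_edge e), Pi.add_apply, dl, r2 e (M.length_mem_edge e)]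
          exact add_comm _ _
    refine ⟨hmem, ?_⟩
    have hs : M.standardLaplacian 𝕜 ⟨R g, hmem⟩ = hr.negSecondDeriv :=
      standardLaplacian_apply hmem hr
    rw [hs]
    refine ext_of_ae_eq fun e => ?_
    have e1 : ((hr.negSecondDeriv - z • R g) e : ℝ → 𝕜) =ᵐ[M.edgeMeasure e]
        hr.negSecondDeriv e - (z • R g e : Lp 𝕜 2 (M.edgeMeasure e)) := Lp.coeFn_sub _ _
    filter_upwards [e1, Lp.coeFn_smul z (R g e), hr.negSecondDeriv_ae_eq e, hr.ae_eq e,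
      hu.edgeDeriv₂_add r1 e, hd e, r3 e] with t e1 e2 e3 e4 e5 e6 e7
    have e4' : (R g e : ℝ → 𝕜) t = u e t + (x.1.1 e * C t + x.1.2 e * S t) := e4
    rw [e1, Pi.sub_apply, e2, e3, Pi.smul_apply, e4', Pi.neg_apply, e5, Pi.add_apply, e6, e7,
      smul_eq_mul]
    ring
  refine ⟨R, hR, fun f => ?_⟩
  -- A right inverse is a left inverse here: `R ((T - z) f) - f` lies in `ker (T - z)`, which is
  -- trivial.
  obtain ⟨hg, hf⟩ := hR (M.standardLaplacian 𝕜 f - z • (f : M.L2 𝕜))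
  rw [← sub_eq_zero, ← Submodule.mem_bot 𝕜, ← hz]
  refine ⟨Submodule.sub_mem _ hg f.2, ?_⟩
  have h1 := (M.standardLaplacian 𝕜).map_sub ⟨_, hg⟩ f
  refine h1.trans ?_
  rw [smul_sub, sub_eq_sub_iff_sub_eq_sub, hf]

/-- Finite-dimensionality makes positive `finrank` equivalent to a nonzero eigenspace. A resolvent
at `z` would map `0 = (T - z) f` to `f`, so it excludes eigenvectors. -/
theorem mem_spectrum_iff [Nonempty E] {z : 𝕜} :
    z ∈ (M.standardLaplacian 𝕜).unboundedSpectrum ↔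
      0 < Module.finrank 𝕜 ((M.standardLaplacian 𝕜).unboundedEigenspace z) := by
  have := finiteDimensional_eigenspace (M := M) z
  rw [Nat.pos_iff_ne_zero, Ne, Submodule.finrank_eq_zero, LinearPMap.unboundedSpectrum,
    mem_compl_iff, not_iff_not]
  refine ⟨?_, mem_resolventSet_of_eigenspace_eq_bot⟩
  rintro ⟨R, -, hR⟩
  rw [Submodule.eq_bot_iff]
  rintro f ⟨hf, h⟩
  have := hR ⟨f, hf⟩
  rw [h, sub_self, map_zero] at this
  exact this.symm

end Resolvent

end MetricGraph

/-! ### The rank of a matrix under field extensions -/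

theorem Matrix.rank_fromBlocks_one {K : Type*} [Field K] (m n : ℕ) :
    (Matrix.fromBlocks (1 : Matrix (Fin m) (Fin m) K) 0 0 (0 : Matrix (Fin n) (Fin n) K)).rank
      = m := by
  classical
  have h : Matrix.fromBlocks (1 : Matrix (Fin m) (Fin m) K) 0 0 (0 : Matrix (Fin n) (Fin n) K) =
      Matrix.diagonal (Sum.elim 1 0) := by
    rw [← Matrix.fromBlocks_diagonal]
    simp
  rw [h, Matrix.rank_diagonal]
  have e : {i : Fin m ⊕ Fin n // (Sum.elim 1 0 : Fin m ⊕ Fin n → K) i ≠ 0} ≃ Fin m :=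
    { toFun := fun i => match i with
        | ⟨Sum.inl a, _⟩ => a
        | ⟨Sum.inr _, h⟩ => absurd rfl h
      invFun := fun a => ⟨Sum.inl a, by simp⟩
      left_inv := by rintro ⟨a | a, h⟩ <;> simp at h ⊢
      right_inv := fun a => rfl }
  rw [Fintype.card_congr e, Fintype.card_fin]

/-- A field homomorphism preserves the rank normal form together with the invertibility of the two
transforming matrices. -/
theorem Matrix.rank_map_ringHom {K L m : Type*} [Field K] [Field L] [Fintype m] [DecidableEq m]
    (φ : K →+* L) (A : Matrix m m K) : (A.map φ).rank = A.rank := by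
  obtain ⟨P, Q, e, hP, hQ, h⟩ := A.exists_rank_normal_form
  have h' := congrArg φ.mapMatrix h
  rw [map_mul, map_mul] at h'
  have hP' : IsUnit (φ.mapMatrix P).det := (Matrix.isUnit_iff_isUnit_det _).1 (hP.map _)
  have hQ' : IsUnit (φ.mapMatrix Q).det := (Matrix.isUnit_iff_isUnit_det _).1 (hQ.map _)
  have hr := congrArg Matrix.rank h'
  rw [Matrix.rank_mul_eq_left_of_isUnit_det _ _ hQ',
    Matrix.rank_mul_eq_right_of_isUnit_det _ _ hP'] at hr
  have hD : φ.mapMatrix ((Matrix.fromBlocks (1 : Matrix (Fin A.rank) (Fin A.rank) K) 0 0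
      (0 : Matrix (Fin (Fintype.card m - A.rank)) (Fin (Fintype.card m - A.rank)) K)).submatrix
        e e) =
      (Matrix.fromBlocks (1 : Matrix (Fin A.rank) (Fin A.rank) L) 0 0 0).submatrix e e := by
    rw [RingHom.mapMatrix_apply, ← Matrix.submatrix_map, Matrix.fromBlocks_map]
    simp
  rw [hD, Matrix.rank_submatrix, Matrix.rank_fromBlocks_one] at hr
  exact hr

/-- Transfers kernel dimensions from the real transition matrix to its extension to `𝕜`, where the
eigenfunctions live. -/
theorem Matrix.finrank_ker_map_ringHom {K L m : Type*} [Field K] [Field L] [Fintype m]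
    [DecidableEq m] (φ : K →+* L) (A : Matrix m m K) :
    Module.finrank L (LinearMap.ker (A.map φ).mulVecLin) =
      Module.finrank K (LinearMap.ker A.mulVecLin) := by
  have h1 := LinearMap.finrank_range_add_finrank_ker (A.map φ).mulVecLin
  have h2 := LinearMap.finrank_range_add_finrank_ker A.mulVecLin
  have h3 := Matrix.rank_map_ringHom φ A
  unfold Matrix.rank at h3
  rw [Module.finrank_fintype_fun_eq_card] at h1 h2
  omega

namespace MetricGraph

variable {V E : Type*} {M : MetricGraph V E} {𝕜 : Type*} [RCLike 𝕜]

/-! ### The energy identity and the sign of the eigenvalues -/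

section Energy

variable [Fintype E] [DecidableEq V] [Fintype V]

/-- Discrete summation by parts: after exchanging the sums, each edge contributes only at its two
ends. -/
theorem sum_mul_kirchhoffSum (c : V → 𝕜) (d₀ d₁ : E → 𝕜) :
    ∑ v, c v * M.kirchhoffSum d₀ d₁ v =
      ∑ e, (c (M.source e) * d₀ e - c (M.target e) * d₁ e) := by
  simp only [kirchhoffSum, Finset.mul_sum]
  rw [Finset.sum_comm]
  refine Finset.sum_congr rfl fun e _ => ?_
  simp [mul_sub, Finset.sum_sub_distrib]

/-- Integration by parts: the Dirichlet form of an eigenfunction. -/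
theorem energy_identity {z : 𝕜} {C S : ℝ → 𝕜} (h : IsFundamentalPair z C S)
    {x : ((E → 𝕜) × (E → 𝕜)) × (V → 𝕜)} (hx : x ∈ LinearMap.ker (M.vertexSystem z C S)) :
    ((∑ e, ∫ t in 0..M.length e, ‖x.1.1 e * -(z * S t) + x.1.2 e * C t‖ ^ 2 : ℝ) : 𝕜) =
      z * ((∑ e, ∫ t in 0..M.length e, ‖x.1.1 e * C t + x.1.2 e * S t‖ ^ 2 : ℝ) : 𝕜) := by
  obtain ⟨h0, h1, h2⟩ := mem_ker_vertexSystem.1 hx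
  have hc := h.continuous_C
  have hs := h.continuous_S
  let u : E → ℝ → 𝕜 := fun e t => x.1.1 e * C t + x.1.2 e * S t
  let w : E → ℝ → 𝕜 := fun e t => x.1.1 e * -(z * S t) + x.1.2 e * C t
  have hu : ∀ e t, HasDerivAt (u e) (w e t) t := fun e t =>
    ((h.hasDerivAt_C t).const_mul _).add ((h.hasDerivAt_S t).const_mul _)
  have hw : ∀ e t, HasDerivAt (w e) (-(z * u e t)) t := fun e t => by
    convert! ((((h.hasDerivAt_S t).const_mul z).neg).const_mul (x.1.1 e)).add
      ((h.hasDerivAt_C t).const_mul (x.1.2 e)) using 1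
    simp only [u]
    ring
  have huc : ∀ e, Continuous (u e) := fun e => by fun_prop
  have hwc : ∀ e, Continuous (w e) := fun e => by fun_prop
  have hconj : ∀ e t, HasDerivAt (fun t => (starRingEnd 𝕜) (u e t)) ((starRingEnd 𝕜) (w e t)) t :=
    fun e t => (RCLike.conjCLE (K := 𝕜)).hasFDerivAt.comp_hasDerivAt t (hu e t)
  -- The integrand is the derivative of `conj u * u'`. Continuity turns the boundary values of `u`
  -- into vertex values, so the boundary terms sum to zero by the Kirchhoff condition.
  have key : ∀ e, ((∫ t in 0..M.length e, ‖w e t‖ ^ 2 : ℝ) : 𝕜) -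
      z * ((∫ t in 0..M.length e, ‖u e t‖ ^ 2 : ℝ) : 𝕜) =
      (starRingEnd 𝕜) (x.2 (M.target e)) * w e (M.length e) -
        (starRingEnd 𝕜) (x.2 (M.source e)) * x.1.2 e := fun e => by
    have hd : ∀ t, HasDerivAt (fun t => (starRingEnd 𝕜) (u e t) * w e t)
        (((‖w e t‖ ^ 2 : ℝ) : 𝕜) - z * ((‖u e t‖ ^ 2 : ℝ) : 𝕜)) t := fun t => by
      convert! (hconj e t).mul (hw e t) using 1
      push_cast
      rw [← RCLike.conj_mul, ← RCLike.conj_mul]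
      ring
    have hw2 : Continuous fun t => ((‖w e t‖ ^ 2 : ℝ) : 𝕜) :=
      RCLike.continuous_ofReal.comp ((hwc e).norm.pow 2)
    have hu2 : Continuous fun t => ((‖u e t‖ ^ 2 : ℝ) : 𝕜) :=
      RCLike.continuous_ofReal.comp ((huc e).norm.pow 2)
    have hi := intervalIntegral.integral_eq_sub_of_hasDerivAt (a := 0) (b := M.length e)
      (fun t _ => hd t) ((hw2.sub (hu2.const_mul z)).intervalIntegrable _ _)
    rw [intervalIntegral.integral_sub (hw2.intervalIntegrable _ _)
      ((hu2.const_mul z).intervalIntegrable _ _), intervalIntegral.integral_const_mul] at hi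
    have hof : ∀ φ : ℝ → ℝ, ∫ t in 0..M.length e, ((φ t : ℝ) : 𝕜) =
        ((∫ t in 0..M.length e, φ t : ℝ) : 𝕜) := fun φ => by
      rw [intervalIntegral.integral_of_le (M.length_pos e).le,
        intervalIntegral.integral_of_le (M.length_pos e).le, integral_ofReal]
    rw [hof, hof] at hi
    rw [hi]
    have e1 : u e (M.length e) = x.2 (M.target e) := h1 e
    have e2 : u e 0 = x.2 (M.source e) := by
      simp only [u, h.C_zero, h.S_zero]
      rw [mul_one, mul_zero, add_zero, h0]
    have e3 : w e 0 = x.1.2 e := by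
      simp only [w, h.C_zero, h.S_zero]
      ring
    rw [e1, e2, e3]
  have hsum := sum_mul_kirchhoffSum (M := M) (fun v => (starRingEnd 𝕜) (x.2 v)) x.1.2
    (fun e => w e (M.length e))
  have hk : M.kirchhoffSum x.1.2 (fun e => w e (M.length e)) = 0 := h2
  rw [hk] at hsum
  simp only [Pi.zero_apply, mul_zero, Finset.sum_const_zero] at hsum
  rw [← sub_eq_zero, RCLike.ofReal_sum, RCLike.ofReal_sum, Finset.mul_sum,
    ← Finset.sum_sub_distrib, Finset.sum_congr rfl fun e _ => key e, ← neg_eq_zero,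
    ← Finset.sum_neg_distrib, hsum]
  exact Finset.sum_congr rfl fun e _ => by ring

/-- The eigenvalue is the Rayleigh quotient `X / Y` of any nonzero eigenfunction. -/
theorem exists_nonneg_of_eigenvalue [Nonempty E] {z : 𝕜}
    (hz : 0 < Module.finrank 𝕜 ((M.standardLaplacian 𝕜).unboundedEigenspace z)) :
    ∃ r : ℝ, 0 ≤ r ∧ z = (r : 𝕜) := by
  obtain ⟨C, S, h⟩ := IsFundamentalPair.exists_pair z
  rw [← (kerEquivEigenspace (M := M) h).finrank_eq, Module.finrank_pos_iff] at hz
  obtain ⟨⟨x, hx⟩, hx0⟩ := exists_ne (0 : LinearMap.ker (M.vertexSystem z C S))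
  have hc := h.continuous_C
  have hs := h.continuous_S
  have hE := energy_identity h hx
  set X := ∑ e, ∫ t in 0..M.length e, ‖x.1.1 e * -(z * S t) + x.1.2 e * C t‖ ^ 2
  set Y := ∑ e, ∫ t in 0..M.length e, ‖x.1.1 e * C t + x.1.2 e * S t‖ ^ 2 with hYdef
  have hX : 0 ≤ X := Finset.sum_nonneg fun e _ =>
    intervalIntegral.integral_nonneg (M.length_pos e).le fun t _ => by positivity
  have hYe : ∀ e, 0 ≤ ∫ t in 0..M.length e, ‖x.1.1 e * C t + x.1.2 e * S t‖ ^ 2 := fun e =>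
    intervalIntegral.integral_nonneg (M.length_pos e).le fun t _ => by positivity
  have hY : 0 ≤ Y := Finset.sum_nonneg fun e _ => hYe e
  have hY0 : Y ≠ 0 := fun hY0 => by
    refine hx0 (Subtype.ext (eq_zero_of_fundamentalL2_eq_zero h hx (ext_of_ae_eq fun e => ?_)))
    have h1 := (Finset.sum_eq_zero_iff_of_nonneg fun e _ => hYe e).1 hY0 e (Finset.mem_univ e)
    rw [intervalIntegral.integral_of_le (M.length_pos e).le, ← integral_Icc_eq_integral_Ioc,
      integral_eq_zero_iff_of_nonneg (fun t => by positivity)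
        (Continuous.integrableOn_Icc (by fun_prop))] at h1
    filter_upwards [(isRep_fundamentalL2 (M := M) h x).1.ae_eq e, h1,
      Lp.coeFn_zero 𝕜 2 (M.edgeMeasure e)] with t e1 e2 e3
    have e4 : x.1.1 e * C t + x.1.2 e * S t = 0 := by simpa using e2
    rw [e1, e4]
    exact e3.symm
  refine ⟨X / Y, by positivity, ?_⟩
  rw [RCLike.ofReal_div, hE, mul_div_assoc, div_self (by exact_mod_cast hY0), mul_one]

end Energy

/-- By connectedness `c` takes only the values `± c v₀`. If `c v₀ ≠ 0`, the sign is a proper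
2-colouring. -/
theorem eq_zero_of_not_bipartite (hM : ¬ M.graph.IsBipartite) {c : V → 𝕜}
    (hc : ∀ e, c (M.source e) = -c (M.target e)) : c = 0 := by
  classical
  by_contra hne
  obtain ⟨v₀, hv₀⟩ := Function.ne_iff.1 hne
  have hv₀' : c v₀ ≠ 0 := hv₀
  have h1 : ∀ v, c v = c v₀ ∨ c v = -c v₀ := M.vertex_induction
    (P := fun v => c v = c v₀ ∨ c v = -c v₀) (fun e => by
      rw [hc, neg_inj, neg_eq_iff_eq_neg, or_comm]) (Or.inl rfl)
  have h2 : c v₀ ≠ -c v₀ := fun h => hv₀' (self_eq_neg.1 h)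
  refine hM ⟨SimpleGraph.Coloring.mk (fun v => if c v = c v₀ then (0 : Fin 2) else 1) ?_⟩
  intro v w hvw
  have h3 : c v = -c w := by
    obtain ⟨e, he⟩ := graph_adj.1 hvw
    rcases Sym2.eq_iff.1 he with ⟨rfl, rfl⟩ | ⟨rfl, rfl⟩
    · exact hc e
    · rw [hc e, neg_neg]
  rcases h1 w with h | h
  · simp [h3, h, h2.symm]
  · simp [h3, h, h2.symm]

/-! ### The incidence matrix -/

section Incidence

variable [DecidableEq V]

/-- The incidence matrix with entry `1` at initial and `-σ` at final vertices. -/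
def incidence (M : MetricGraph V E) (σ : 𝕜) : Matrix V E 𝕜 :=
  Matrix.of fun v e => (if v = M.source e then 1 else 0) - if v = M.target e then σ else 0

theorem mem_ker_incidence [Fintype E] {σ : 𝕜} {b : E → 𝕜} :
    b ∈ LinearMap.ker (M.incidence σ).mulVecLin ↔ M.kirchhoffSum b (fun e => b e * σ) = 0 := by
  rw [LinearMap.mem_ker, funext_iff, funext_iff]
  refine forall_congr' fun v => ?_
  have : (M.incidence σ).mulVecLin b v = M.kirchhoffSum b (fun e => b e * σ) v := by
    simp only [Matrix.mulVecLin_apply, Matrix.mulVec, dotProduct, incidence, Matrix.of_apply,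
      kirchhoffSum]
    refine Finset.sum_congr rfl fun e _ => ?_
    split_ifs <;> ring
  rw [this]

variable [Fintype V]

theorem mem_ker_incidence_transpose {σ : 𝕜} {c : V → 𝕜} :
    c ∈ LinearMap.ker (M.incidence σ).transpose.mulVecLin ↔
      ∀ e, c (M.source e) = σ * c (M.target e) := by
  rw [LinearMap.mem_ker, funext_iff]
  refine forall_congr' fun e => ?_
  have : (M.incidence σ).transpose.mulVecLin c e = c (M.source e) - σ * c (M.target e) := by
    simp only [Matrix.mulVecLin_apply, Matrix.mulVec, dotProduct, Matrix.transpose_apply,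
      incidence, Matrix.of_apply, sub_mul, Finset.sum_sub_distrib, ite_mul, one_mul, zero_mul,
      Finset.sum_ite_eq', Finset.mem_univ, if_true]
  rw [this]
  exact sub_eq_zero

/-- Rank-nullity for the matrix and for its transpose, which have equal rank. The statement is in
`ℤ` since `|E| - |V|` is `-1` for a tree. -/
theorem finrank_ker_incidence [Fintype E] (M : MetricGraph V E) (σ : 𝕜) :
    (Module.finrank 𝕜 (LinearMap.ker (M.incidence σ).mulVecLin) : ℤ) =
      Fintype.card E - Fintype.card V +
        Module.finrank 𝕜 (LinearMap.ker (M.incidence σ).transpose.mulVecLin) := by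
  have h1 := LinearMap.finrank_range_add_finrank_ker (M.incidence σ).mulVecLin
  have h2 := LinearMap.finrank_range_add_finrank_ker (M.incidence σ).transpose.mulVecLin
  have h3 := (M.incidence σ).rank_transpose
  unfold Matrix.rank at h3
  rw [Module.finrank_fintype_fun_eq_card] at h1 h2
  omega

/-- For any other solution `c` the quotient `c / ε` is equal at the two ends of each edge, hence
constant. -/
theorem finrank_ker_incidence_transpose_eq_one {σ : 𝕜} (hσ : σ ≠ 0) (v₀ : V) {ε : V → 𝕜}
    (hε : ∀ v, ε v ≠ 0) (h : ∀ e, ε (M.source e) = σ * ε (M.target e)) :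
    Module.finrank 𝕜 (LinearMap.ker (M.incidence σ).transpose.mulVecLin) = 1 := by
  refine finrank_eq_one (v := ⟨ε, mem_ker_incidence_transpose.2 h⟩)
    (fun h0 => hε v₀ (congrFun (congrArg Subtype.val h0) v₀)) ?_
  rintro ⟨c, hc⟩
  rw [mem_ker_incidence_transpose] at hc
  refine ⟨c v₀ / ε v₀, Subtype.ext (funext fun v => ?_)⟩
  have := M.vertex_induction (P := fun v => c v / ε v = c v₀ / ε v₀) (fun e => by
    rw [hc, h, mul_div_mul_left _ _ hσ]) (v := v₀) rfl v
  change c v₀ / ε v₀ * ε v = c v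
  rw [← this, div_mul_cancel₀ _ (hε v)]

theorem finrank_ker_incidence_one [Nonempty E] (M : MetricGraph V E) :
    Module.finrank 𝕜 (LinearMap.ker (M.incidence (1 : 𝕜)).transpose.mulVecLin) = 1 :=
  finrank_ker_incidence_transpose_eq_one one_ne_zero (M.source (Classical.arbitrary E))
    (ε := fun _ => 1) (fun _ => one_ne_zero) (fun e => by simp)

theorem finrank_ker_incidence_neg_one_of_bipartite [Nonempty E] (hM : M.graph.IsBipartite) :
    Module.finrank 𝕜 (LinearMap.ker (M.incidence (-1 : 𝕜)).transpose.mulVecLin) = 1 := by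
  obtain ⟨col⟩ := hM
  refine finrank_ker_incidence_transpose_eq_one (by simp) (M.source (Classical.arbitrary E))
    (ε := fun v => if col v = 0 then 1 else -1) (fun v => by split_ifs <;> simp) (fun e => ?_)
  have := col.valid (adj_source_target (M := M) e)
  by_cases h1 : col (M.source e) = 0 <;> by_cases h2 : col (M.target e) = 0 <;> simp [h1, h2]
  · exact absurd (h1.trans h2.symm) this
  · omega

theorem finrank_ker_incidence_neg_one_of_not_bipartite (hM : ¬ M.graph.IsBipartite) :
    Module.finrank 𝕜 (LinearMap.ker (M.incidence (-1 : 𝕜)).transpose.mulVecLin) = 0 := by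
  rw [Submodule.finrank_eq_zero, Submodule.eq_bot_iff]
  intro c hc
  rw [mem_ker_incidence_transpose] at hc
  exact eq_zero_of_not_bipartite hM fun e => (hc e).trans (neg_one_mul _)

end Incidence

/-! ### The transition matrix -/

theorem mem_spectrum_transitionMatrix [Fintype V] [DecidableEq V] {r : ℝ} :
    r ∈ spectrum ℝ M.transitionMatrix ↔
      0 < Module.finrank ℝ (LinearMap.ker (M.transitionMatrix - r • 1).mulVecLin) := by
  rw [spectrum.mem_iff, ← IsUnit.neg_iff, neg_sub, Matrix.isUnit_iff_isUnit_det,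
    isUnit_iff_ne_zero, not_not, ← Matrix.exists_mulVec_eq_zero_iff, Module.finrank_pos_iff,
    Submodule.nontrivial_iff_ne_bot, Submodule.ne_bot_iff, Algebra.algebraMap_eq_smul_one]
  exact exists_congr fun c => and_comm

section Transition

variable [Fintype E] [DecidableEq V]

/-- Each edge accounts for two symmetric entries; since there are no multiple edges, the sum over
edges is `0` or `1`. -/
theorem adjacencyMatrix_apply (v w : V) :
    ((M.adjacencyMatrix v w : ℝ) : 𝕜) =
      ∑ e, ((if v = M.source e ∧ w = M.target e then 1 else 0) +
        if v = M.target e ∧ w = M.source e then 1 else 0) := by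
  classical
  unfold adjacencyMatrix
  rw [SimpleGraph.adjMatrix_apply]
  have key : ∀ e, ((if v = M.source e ∧ w = M.target e then (1 : 𝕜) else 0) +
        if v = M.target e ∧ w = M.source e then 1 else 0) =
      if s(M.source e, M.target e) = s(v, w) then 1 else 0 := fun e => by
    have := M.source_ne_target e
    simp only [Sym2.eq_iff]
    by_cases h1 : v = M.source e
    · subst h1
      simp [this, eq_comm]
    · by_cases h2 : v = M.target e
      · subst h2
        simp [this, this.symm, eq_comm]
      · simp [h1, h2, Ne.symm h1, Ne.symm h2]
  rw [Finset.sum_congr rfl fun e _ => key e]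
  by_cases h : M.graph.Adj v w
  · obtain ⟨e, he⟩ := graph_adj.1 h
    rw [if_pos h, Finset.sum_eq_single e (fun e' _ hne => if_neg fun he' =>
      hne (M.edge_injective (he'.trans he.symm))) (by simp), if_pos he, RCLike.ofReal_one]
  · rw [if_neg h, RCLike.ofReal_zero, Finset.sum_eq_zero fun e _ =>
      if_neg fun he => h (graph_adj.2 ⟨e, he⟩)]

variable [Fintype V]

/-- Written as a Kirchhoff sum so that it can be compared with vertex conditions edge by edge; the
sign in the second argument cancels the one in `kirchhoffSum`. -/
theorem sum_adjacencyMatrix_mul (c : V → 𝕜) (v : V) :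
    ∑ w, ((M.adjacencyMatrix v w : ℝ) : 𝕜) * c w =
      M.kirchhoffSum (fun e => c (M.target e)) (fun e => -c (M.source e)) v := by
  simp only [adjacencyMatrix_apply, Finset.sum_mul]
  rw [Finset.sum_comm]
  refine Finset.sum_congr rfl fun e _ => ?_
  simp only [add_mul, Finset.sum_add_distrib, ite_and]
  have hne := M.source_ne_target e
  by_cases h1 : v = M.source e
  · subst h1
    simp [hne]
  · by_cases h2 : v = M.target e
    · subst h2
      simp [hne.symm]
    · simp [h1, h2]

theorem adjacencyMatrix_mulVec_one_mul (c : V → 𝕜) (v : V) :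
    ((M.adjacencyMatrix.mulVec 1 v : ℝ) : 𝕜) * c v =
      M.kirchhoffSum (fun e => c (M.source e)) (fun e => -c (M.target e)) v := by
  have h1 : ((M.adjacencyMatrix.mulVec 1 v : ℝ) : 𝕜) =
      M.kirchhoffSum (fun _ => 1) (fun _ => -1) v := by
    rw [← sum_adjacencyMatrix_mul (M := M) (fun _ => (1 : 𝕜)) v]
    simp [Matrix.mulVec, dotProduct]
  rw [h1]
  simp only [kirchhoffSum, Finset.sum_mul]
  refine Finset.sum_congr rfl fun e _ => ?_
  have hne := M.source_ne_target e
  by_cases h1 : v = M.source e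
  · subst h1
    simp [hne]
  · by_cases h2 : v = M.target e
    · subst h2
      simp [hne.symm]
    · simp [h1, h2]

/-- Every vertex has an incident edge, so no degree vanishes and the inverse in the transition
matrix is a genuine one. -/
theorem adjacencyMatrix_mulVec_one_pos [Nonempty E] (v : V) :
    0 < M.adjacencyMatrix.mulVec 1 v := by
  have h := adjacencyMatrix_mulVec_one_mul (M := M) (𝕜 := ℝ) 1 v
  simp only [RCLike.ofReal_real_eq_id, id, Pi.one_apply, mul_one] at h
  rw [h]
  obtain ⟨e, he⟩ := M.exists_incident_edge v
  refine Finset.sum_pos' (fun e _ => by split_ifs <;> norm_num) ⟨e, Finset.mem_univ e, ?_⟩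
  rcases Sym2.mem_iff.1 he with h | h
  · rw [if_pos h]
    split_ifs <;> norm_num
  · rw [if_pos h]
    split_ifs <;> norm_num

theorem transitionMatrix_apply [Nonempty E] (v w : V) :
    M.transitionMatrix v w = (M.adjacencyMatrix.mulVec 1 v)⁻¹ * M.adjacencyMatrix v w := by
  have h : (Matrix.diagonal (M.adjacencyMatrix.mulVec 1))⁻¹ =
      Matrix.diagonal fun v => (M.adjacencyMatrix.mulVec 1 v)⁻¹ := by
    refine Matrix.inv_eq_left_inv ?_
    rw [Matrix.diagonal_mul_diagonal, ← Matrix.diagonal_one]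
    congr 1
    funext v
    exact inv_mul_cancel₀ (adjacencyMatrix_mulVec_one_pos v).ne'
  rw [transitionMatrix, h, Matrix.diagonal_mul]

/-- The Kirchhoff sum is `(Z - r) c` multiplied at each vertex by its degree, which is nonzero. -/
theorem mem_ker_transitionMatrix_sub [Nonempty E] {r : ℝ} {c : V → 𝕜} :
    c ∈ LinearMap.ker ((M.transitionMatrix - r • 1).map (algebraMap ℝ 𝕜)).mulVecLin ↔
      M.kirchhoffSum (fun e => c (M.target e) - r * c (M.source e))
        (fun e => -(c (M.source e) - r * c (M.target e))) = 0 := by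
  rw [LinearMap.mem_ker, funext_iff, funext_iff]
  refine forall_congr' fun v => ?_
  have hd : ((M.adjacencyMatrix.mulVec 1 v : ℝ) : 𝕜) ≠ 0 := by
    exact_mod_cast (adjacencyMatrix_mulVec_one_pos (M := M) v).ne'
  have e1 : ((M.transitionMatrix - r • 1).map (algebraMap ℝ 𝕜)).mulVecLin c v =
      ((M.adjacencyMatrix.mulVec 1 v : ℝ) : 𝕜)⁻¹ *
        (∑ w, ((M.adjacencyMatrix v w : ℝ) : 𝕜) * c w) - r * c v := by
    simp only [Matrix.mulVecLin_apply, Matrix.mulVec, dotProduct, Matrix.map_apply,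
      Matrix.sub_apply, Matrix.smul_apply, Matrix.one_apply, transitionMatrix_apply, map_sub,
      map_mul, sub_mul, Finset.sum_sub_distrib, Finset.mul_sum, smul_eq_mul]
    congr 1
    · refine Finset.sum_congr rfl fun w _ => ?_
      simp [mul_assoc]
    · simp
  have e2 : M.kirchhoffSum (fun e => c (M.target e) - r * c (M.source e))
      (fun e => -(c (M.source e) - r * c (M.target e))) v =
      ((M.adjacencyMatrix.mulVec 1 v : ℝ) : 𝕜) *
        (((M.transitionMatrix - r • 1).map (algebraMap ℝ 𝕜)).mulVecLin c v) := by
    rw [e1, mul_sub, mul_inv_cancel_left₀ hd, mul_left_comm, sum_adjacencyMatrix_mul,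
      adjacencyMatrix_mulVec_one_mul]
    simp only [kirchhoffSum, Finset.mul_sum, ← Finset.sum_sub_distrib]
    refine Finset.sum_congr rfl fun e _ => ?_
    split_ifs <;> ring
  rw [e2]
  simp [hd]

/-- If `-1` is an eigenvalue of the transition matrix, then the graph is bipartite. -/
theorem isBipartite_of_neg_one_mem_spectrum [Nonempty E]
    (h : (-1 : ℝ) ∈ spectrum ℝ M.transitionMatrix) : M.graph.IsBipartite := by
  by_contra hM
  rw [mem_spectrum_transitionMatrix, Module.finrank_pos_iff] at h
  obtain ⟨⟨c, hc⟩, hc0⟩ := exists_ne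
    (0 : LinearMap.ker (M.transitionMatrix - (-1 : ℝ) • 1).mulVecLin)
  have hk := (mem_ker_transitionMatrix_sub (M := M) (𝕜 := ℝ) (r := -1) (c := c)).1 hc
  have hs := sum_mul_kirchhoffSum (M := M) c
    (fun e => c (M.target e) - (-1 : ℝ) * c (M.source e))
    (fun e => -(c (M.source e) - (-1 : ℝ) * c (M.target e)))
  have hk' : M.kirchhoffSum (fun e => c (M.target e) - (-1 : ℝ) * c (M.source e))
    (fun e => -(c (M.source e) - (-1 : ℝ) * c (M.target e))) = 0 := hk
  rw [hk'] at hs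
  simp only [Pi.zero_apply, mul_zero, Finset.sum_const_zero] at hs
  -- Pairing `Diag(A e) (Z + 1) c = 0` with `c` gives this signless Dirichlet form.
  have hsq : ∑ e, (c (M.source e) + c (M.target e)) ^ 2 = 0 := by
    rw [hs]
    exact Finset.sum_congr rfl fun e _ => by ring
  refine hc0 (Subtype.ext (eq_zero_of_not_bipartite hM fun e => ?_))
  have := (Finset.sum_eq_zero_iff_of_nonneg fun e _ => sq_nonneg _).1 hsq e (Finset.mem_univ e)
  exact eq_neg_of_add_eq_zero_left (pow_eq_zero_iff two_ne_zero |>.1 this)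

theorem one_mem_spectrum [Nonempty E] : (1 : ℝ) ∈ spectrum ℝ M.transitionMatrix := by
  rw [mem_spectrum_transitionMatrix, Module.finrank_pos_iff]
  have h1 : (1 : V → ℝ) ∈ LinearMap.ker (M.transitionMatrix - (1 : ℝ) • 1).mulVecLin :=
    (mem_ker_transitionMatrix_sub (M := M) (𝕜 := ℝ) (r := 1) (c := 1)).2 (by
      funext v
      simp [kirchhoffSum])
  exact ⟨⟨_, h1⟩, 0, fun h => one_ne_zero
    (congrFun (congrArg Subtype.val h) (M.source (Classical.arbitrary E)))⟩

end Transition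

end MetricGraph

namespace MetricGraph

variable {V E : Type*} {M : MetricGraph V E} {𝕜 : Type*} [RCLike 𝕜]

/-! ### Dimensions of the eigenspaces -/

section Dimension

variable [Fintype E] [DecidableEq V] [Fintype V] {z : 𝕜} {C S : ℝ → 𝕜} {l : ℝ}

/-- Since `S l ≠ 0`, the values at both ends fix the initial slope `b = (c(target) - C c(source)) /
S` on each edge. Projecting to `c` is therefore injective, and the Kirchhoff condition is `S⁻¹`
times the one in `mem_ker_transitionMatrix_sub`. -/
theorem finrank_ker_vertexSystem_of_ne_zero [Nonempty E] (h : IsFundamentalPair z C S)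
    (hl : M.IsEquilateral l) (hS : S l ≠ 0) {r : ℝ} (hC : C l = r) :
    Module.finrank 𝕜 (LinearMap.ker (M.vertexSystem z C S)) =
      Module.finrank ℝ (LinearMap.ker (M.transitionMatrix - r • 1).mulVecLin) := by
  rw [← Matrix.finrank_ker_map_ringHom (algebraMap ℝ 𝕜)]
  have hW := h.wronskian l
  have hker : ∀ c : V → 𝕜, c ∈ LinearMap.ker
      ((M.transitionMatrix - r • 1).map (algebraMap ℝ 𝕜)).mulVecLin ↔
      M.kirchhoffSum (fun e => (S l)⁻¹ * (c (M.target e) - C l * c (M.source e)))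
        (fun e => c (M.source e) * -(z * S l) +
          (S l)⁻¹ * (c (M.target e) - C l * c (M.source e)) * C l) = 0 := fun c => by
    rw [mem_ker_transitionMatrix_sub]
    have h1 := (M.kirchhoffMap 𝕜).map_smul (S l)⁻¹
      (fun e => c (M.target e) - r * c (M.source e),
        fun e => -(c (M.source e) - r * c (M.target e)))
    have h2 : (M.kirchhoffMap 𝕜) ((S l)⁻¹ • (fun e => c (M.target e) - r * c (M.source e),
        fun e => -(c (M.source e) - r * c (M.target e)))) =
        M.kirchhoffSum (fun e => (S l)⁻¹ * (c (M.target e) - C l * c (M.source e)))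
        (fun e => c (M.source e) * -(z * S l) +
          (S l)⁻¹ * (c (M.target e) - C l * c (M.source e)) * C l) := by
      change M.kirchhoffSum _ _ = _
      congr 1
      · funext e
        simp [hC]
      · funext e
        simp only [Prod.smul_mk, Pi.smul_apply, smul_eq_mul, ← hC]
        field_simp
        -- The Wronskian identity turns the final slope into `-(c(source) - C c(target)) / S`, the
        -- mirror image of the initial one.
        linear_combination c (M.source e) * hW
    rw [← h2, h1, smul_eq_zero, or_iff_right (inv_ne_zero hS)]
    rfl
  let φ := (LinearMap.snd 𝕜 ((E → 𝕜) × (E → 𝕜)) (V → 𝕜)).domRestrict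
    (LinearMap.ker (M.vertexSystem z C S))
  have hb : ∀ x ∈ LinearMap.ker (M.vertexSystem z C S),
      x.1.1 = (fun e => x.2 (M.source e)) ∧
      x.1.2 = fun e => (S l)⁻¹ * (x.2 (M.target e) - C l * x.2 (M.source e)) := fun x hx => by
    obtain ⟨h0, h1, -⟩ := mem_ker_vertexSystem.1 hx
    refine ⟨funext h0, funext fun e => ?_⟩
    have := h1 e
    rw [hl e, h0] at this
    rw [← this]
    field_simp
    ring
  have hφ : Function.Injective φ := by
    rw [← LinearMap.ker_eq_bot, LinearMap.ker_eq_bot']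
    rintro ⟨x, hx⟩ h0
    have h0' : x.2 = 0 := h0
    obtain ⟨h1, h2⟩ := hb x hx
    refine Subtype.ext (Prod.ext (Prod.ext ?_ ?_) h0')
    · rw [h1, h0']
      rfl
    · rw [h2, h0']
      simp
      rfl
  suffices hrange : LinearMap.range φ = LinearMap.ker
      ((M.transitionMatrix - r • 1).map (algebraMap ℝ 𝕜)).mulVecLin by
    rw [← LinearMap.finrank_range_of_inj hφ, hrange]
  ext c
  rw [hker]
  constructor
  · rintro ⟨⟨x, hx⟩, rfl⟩
    obtain ⟨-, -, h2⟩ := mem_ker_vertexSystem.1 hx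
    simp only [hl _] at h2
    rw [(hb x hx).1, (hb x hx).2] at h2
    exact h2
  · intro hc
    refine ⟨⟨((fun e => c (M.source e),
      fun e => (S l)⁻¹ * (c (M.target e) - C l * c (M.source e))), c), ?_⟩, rfl⟩
    refine mem_ker_vertexSystem.2 ⟨fun e => rfl, fun e => ?_, ?_⟩
    · simp only [hl e]
      field_simp
      ring
    · simp only [hl _]
      exact hc

/-- With `S l = 0` the slopes `b` drop out of the continuity conditions and the values `a` out of
the Kirchhoff conditions. The two independent parts are the kernels of the incidence matrix and of
its transpose. -/
theorem finrank_ker_vertexSystem_of_eq_zero (hl : M.IsEquilateral l) (hS : S l = 0)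
    {σ : 𝕜} (hC : C l = σ) (hσ : σ * σ = 1) :
    (Module.finrank 𝕜 (LinearMap.ker (M.vertexSystem z C S)) : ℤ) =
      Fintype.card E - Fintype.card V +
        2 * Module.finrank 𝕜 (LinearMap.ker (M.incidence σ).transpose.mulVecLin) := by
  have hker : ∀ x, x ∈ LinearMap.ker (M.vertexSystem z C S) ↔
      x.1.1 = (fun e => x.2 (M.source e)) ∧
      x.2 ∈ LinearMap.ker (M.incidence σ).transpose.mulVecLin ∧
      x.1.2 ∈ LinearMap.ker (M.incidence σ).mulVecLin := fun x => by
    rw [mem_ker_vertexSystem, mem_ker_incidence_transpose, mem_ker_incidence]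
    simp only [hl _, hS, hC, mul_zero, add_zero, neg_zero, zero_add]
    rw [← funext_iff]
    refine and_congr_right fun h0 => and_congr_left fun _ => forall_congr' fun e => ?_
    rw [h0]
    constructor
    · intro h1
      linear_combination σ * h1 - x.2 (M.source e) * hσ
    · intro h1
      linear_combination σ * h1 + x.2 (M.target e) * hσ
  let φ : LinearMap.ker (M.vertexSystem z C S) ≃ₗ[𝕜]
      LinearMap.ker (M.incidence σ).mulVecLin ×
        LinearMap.ker (M.incidence σ).transpose.mulVecLin :=
    { toFun := fun x => (⟨x.1.1.2, ((hker x).1 x.2).2.2⟩, ⟨x.1.2, ((hker x).1 x.2).2.1⟩)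
      invFun := fun y => ⟨((fun e => y.2.1 (M.source e), y.1), y.2),
        (hker _).2 ⟨rfl, y.2.2, y.1.2⟩⟩
      map_add' := fun _ _ => rfl
      map_smul' := fun _ _ => rfl
      left_inv := fun x => Subtype.ext (Prod.ext (Prod.ext ((hker x).1 x.2).1.symm rfl) rfl)
      right_inv := fun _ => rfl }
  rw [φ.finrank_eq, Module.finrank_prod, Nat.cast_add, finrank_ker_incidence]
  ring

/-- At `z = 0` solutions are affine on the edges, with fundamental pair `1`, `t`. The energy
argument forces all slopes to vanish, and connectedness makes the function constant. -/
theorem finrank_eigenspace_zero [Nonempty E] (M : MetricGraph V E) :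
    Module.finrank 𝕜 ((M.standardLaplacian 𝕜).unboundedEigenspace 0) = 1 := by
  have h : IsFundamentalPair (0 : 𝕜) (fun _ => 1) (fun t => (t : 𝕜)) :=
    { hasDerivAt_C := fun t => by simpa using hasDerivAt_const t (1 : 𝕜)
      hasDerivAt_S := fun t => by
        simpa using! (RCLike.ofRealCLM (K := 𝕜)).hasDerivAt (x := t)
      C_zero := rfl
      S_zero := RCLike.ofReal_zero }
  rw [← (kerEquivEigenspace (M := M) h).finrank_eq]
  have hmem : (((1, 0), 1) : ((E → 𝕜) × (E → 𝕜)) × (V → 𝕜)) ∈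
      LinearMap.ker (M.vertexSystem (0 : 𝕜) (fun _ => 1) (fun t => (t : 𝕜))) :=
    mem_ker_vertexSystem.2 ⟨fun e => rfl, fun e => by simp, by
      funext v
      simp [kirchhoffSum]⟩
  let v₀ := M.source (Classical.arbitrary E)
  refine finrank_eq_one (v := ⟨_, hmem⟩) (fun h0 => one_ne_zero
    (congrFun (congrArg (fun x => x.1.2) h0) v₀)) ?_
  rintro ⟨x, hx⟩
  obtain ⟨h0, h1, h2⟩ := mem_ker_vertexSystem.1 hx
  have hs := sum_mul_kirchhoffSum (M := M) (fun v => (starRingEnd 𝕜) (x.2 v)) x.1.2 x.1.2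
  have h2' : M.kirchhoffSum x.1.2 x.1.2 = 0 := by
    rw [← h2]
    congr 1
    funext e
    simp
  rw [h2'] at hs
  simp only [Pi.zero_apply, mul_zero, Finset.sum_const_zero] at hs
  -- Pairing the Kirchhoff condition with `conj c` yields the Dirichlet energy of the affine
  -- functions, since `c(target) - c(source)` is length times slope.
  have hsum : ∑ e, M.length e * ‖x.1.2 e‖ ^ 2 = 0 := by
    have : ((∑ e, M.length e * ‖x.1.2 e‖ ^ 2 : ℝ) : 𝕜) = 0 := by
      rw [← neg_eq_zero, hs, RCLike.ofReal_sum, ← Finset.sum_neg_distrib]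
      refine Finset.sum_congr rfl fun e _ => ?_
      rw [← h1, h0, map_add, map_mul, map_mul, RCLike.conj_ofReal, map_one]
      push_cast
      rw [← RCLike.conj_mul]
      ring
    exact_mod_cast this
  have hb : ∀ e, x.1.2 e = 0 := fun e => by
    have := (Finset.sum_eq_zero_iff_of_nonneg fun e _ =>
      mul_nonneg (M.length_pos e).le (sq_nonneg _)).1 hsum e (Finset.mem_univ e)
    simpa [(M.length_pos e).ne'] using this
  have hc : ∀ v, x.2 v = x.2 v₀ := M.vertex_induction (P := fun v => x.2 v = x.2 v₀) (fun e => by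
    rw [← h1, h0, hb, mul_one, zero_mul, add_zero]) rfl
  refine ⟨x.2 v₀, Subtype.ext (Prod.ext (Prod.ext (funext fun e => ?_) (funext fun e => ?_))
    (funext fun v => ?_))⟩
  · change x.2 v₀ * 1 = x.1.1 e
    rw [h0, hc (M.source e), mul_one]
  · change x.2 v₀ * 0 = x.1.2 e
    rw [hb, mul_zero]
  · change x.2 v₀ * 1 = x.2 v
    rw [hc v, mul_one]

variable [Nonempty E] {x : ℝ}

theorem isFundamentalPair_sqrt (hx : 0 < x) :
    IsFundamentalPair (x : 𝕜) (fun t => (Real.cos (√x * t) : 𝕜))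
      (fun t => ((Real.sin (√x * t) / √x : ℝ) : 𝕜)) := by
  have := IsFundamentalPair.trigonometric (𝕜 := 𝕜) (Real.sqrt_pos.2 hx).ne'
  rwa [Real.sq_sqrt hx.le] at this

theorem finrank_eigenspace_of_sin_ne_zero (hl : M.IsEquilateral l) (hx : 0 < x)
    (hs : Real.sin (√x * l) ≠ 0) :
    Module.finrank 𝕜 ((M.standardLaplacian 𝕜).unboundedEigenspace (x : 𝕜)) =
      Module.finrank ℝ
        (LinearMap.ker (M.transitionMatrix - Real.cos (√x * l) • 1).mulVecLin) := by
  rw [← (kerEquivEigenspace (M := M) (isFundamentalPair_sqrt hx)).finrank_eq]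
  refine finrank_ker_vertexSystem_of_ne_zero (isFundamentalPair_sqrt hx) hl ?_ rfl
  exact_mod_cast div_ne_zero hs (Real.sqrt_pos.2 hx).ne'

theorem finrank_eigenspace_of_cos_sq (hl : M.IsEquilateral l) (hx : 0 < x) {σ : ℝ}
    (hc : Real.cos (√x * l) = σ) (hσ : σ * σ = 1) :
    (Module.finrank 𝕜 ((M.standardLaplacian 𝕜).unboundedEigenspace (x : 𝕜)) : ℤ) =
      Fintype.card E - Fintype.card V +
        2 * Module.finrank 𝕜 (LinearMap.ker (M.incidence (σ : 𝕜)).transpose.mulVecLin) := by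
  have hs : Real.sin (√x * l) = 0 := by
    have := Real.sin_sq_add_cos_sq (√x * l)
    rw [hc] at this
    exact pow_eq_zero_iff two_ne_zero |>.1 (by linarith)
  rw [← (kerEquivEigenspace (M := M) (isFundamentalPair_sqrt hx)).finrank_eq]
  exact finrank_ker_vertexSystem_of_eq_zero hl (by simp [hs]) (by rw [hc]) (by exact_mod_cast hσ)

theorem finrank_eigenspace_of_cos_eq_one (hl : M.IsEquilateral l) (hx : 0 < x)
    (hc : Real.cos (√x * l) = 1) :
    (Module.finrank 𝕜 ((M.standardLaplacian 𝕜).unboundedEigenspace (x : 𝕜)) : ℤ) =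
      Fintype.card E - Fintype.card V + 2 := by
  rw [finrank_eigenspace_of_cos_sq hl hx hc (by norm_num), RCLike.ofReal_one,
    finrank_ker_incidence_one]
  rfl

theorem finrank_eigenspace_of_bipartite (hl : M.IsEquilateral l) (hx : 0 < x)
    (hc : Real.cos (√x * l) = -1) (hM : M.graph.IsBipartite) :
    (Module.finrank 𝕜 ((M.standardLaplacian 𝕜).unboundedEigenspace (x : 𝕜)) : ℤ) =
      Fintype.card E - Fintype.card V + 2 := by
  rw [finrank_eigenspace_of_cos_sq hl hx hc (by norm_num), RCLike.ofReal_neg, RCLike.ofReal_one,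
    finrank_ker_incidence_neg_one_of_bipartite hM]
  rfl

theorem finrank_eigenspace_of_not_bipartite (hl : M.IsEquilateral l) (hx : 0 < x)
    (hc : Real.cos (√x * l) = -1) (hM : ¬ M.graph.IsBipartite) :
    (Module.finrank 𝕜 ((M.standardLaplacian 𝕜).unboundedEigenspace (x : 𝕜)) : ℤ) =
      Fintype.card E - Fintype.card V := by
  rw [finrank_eigenspace_of_cos_sq hl hx hc (by norm_num), RCLike.ofReal_neg, RCLike.ofReal_one,
    finrank_ker_incidence_neg_one_of_not_bipartite hM]
  simp

/-- The kernel of the incidence matrix has dimension `N - n + 1`, which cannot be negative. Hence `N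
- n + 2` is a positive multiplicity. -/
theorem card_vertices_le (M : MetricGraph V E) : Fintype.card V ≤ Fintype.card E + 1 := by
  have h := finrank_ker_incidence (𝕜 := ℝ) M 1
  rw [finrank_ker_incidence_one] at h
  omega

theorem finrank_eigenspace_pos_iff (hl : M.IsEquilateral l) (hx : 0 < x) :
    0 < Module.finrank 𝕜 ((M.standardLaplacian 𝕜).unboundedEigenspace (x : 𝕜)) ↔
      Real.cos (√x * l) ∈ spectrum ℝ M.transitionMatrix ∨ (Real.cos (√x * l) = -1 ∧
        ¬ (¬ M.graph.IsBipartite ∧ Fintype.card E = Fintype.card V)) := by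
  have hVE := M.card_vertices_le
  by_cases h1 : Real.cos (√x * l) = 1
  · have := finrank_eigenspace_of_cos_eq_one (𝕜 := 𝕜) hl hx h1
    refine iff_of_true (by omega) (Or.inl ?_)
    rw [h1]
    exact one_mem_spectrum
  by_cases h2 : Real.cos (√x * l) = -1
  · by_cases hM : M.graph.IsBipartite
    · have := finrank_eigenspace_of_bipartite (𝕜 := 𝕜) hl hx h2 hM
      exact iff_of_true (by omega) (Or.inr ⟨h2, fun h => h.1 hM⟩)
    · have := finrank_eigenspace_of_not_bipartite (𝕜 := 𝕜) hl hx h2 hM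
      -- Ensures that the value omitted in the exceptional case does not re-enter through the
      -- spectrum of `Z`.
      have hn : Real.cos (√x * l) ∉ spectrum ℝ M.transitionMatrix := fun h => by
        rw [h2] at h
        exact hM (isBipartite_of_neg_one_mem_spectrum h)
      rw [or_iff_right hn, and_iff_right h2, not_and, imp_iff_right hM]
      omega
  · have hs : Real.sin (√x * l) ≠ 0 := fun h => by
      rcases Real.sin_eq_zero_iff_cos_eq.1 h with h | h
      exacts [h1 h, h2 h]
    rw [finrank_eigenspace_of_sin_ne_zero hl hx hs, mem_spectrum_transitionMatrix]
    simp [h2]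

end Dimension

end MetricGraph

/-! ### The spectrum and the multiplicities -/

theorem mainTheorem1 {𝕜 : Type*} [RCLike 𝕜] {V E : Type*} [Fintype V] [DecidableEq V]
    [Fintype E] [Nonempty E] (M : MetricGraph V E) (l : ℝ) (hl : M.IsEquilateral l) :
    ((M.standardLaplacian 𝕜).unboundedSpectrum =
      (fun x : ℝ => (x : 𝕜)) ''
        ({0} ∪ {x : ℝ | 0 < x ∧ Real.cos (√x * l) ∈ spectrum ℝ M.transitionMatrix} ∪
          {x : ℝ | 0 < x ∧ Real.cos (√x * l) = -1 ∧
            ¬ (¬ M.graph.IsBipartite ∧ Fintype.card E = Fintype.card V)})) ∧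
    (∀ x : ℝ, 0 ≤ x →
      FiniteDimensional 𝕜 ((M.standardLaplacian 𝕜).unboundedEigenspace (x : 𝕜))) ∧
    Module.finrank 𝕜 ((M.standardLaplacian 𝕜).unboundedEigenspace 0) = 1 ∧
    (∀ x : ℝ, 0 < x → Real.sin (√x * l) ≠ 0 →
      Module.finrank 𝕜 ((M.standardLaplacian 𝕜).unboundedEigenspace (x : 𝕜)) =
        Module.finrank ℝ (LinearMap.ker
          (Matrix.toLin' (M.transitionMatrix - Real.cos (√x * l) • (1 : Matrix V V ℝ))))) ∧
    (∀ x : ℝ, 0 < x → Real.cos (√x * l) = 1 →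
      (Module.finrank 𝕜 ((M.standardLaplacian 𝕜).unboundedEigenspace (x : 𝕜)) : ℤ) =
        Fintype.card E - Fintype.card V + 2) ∧
    (∀ x : ℝ, 0 < x → Real.cos (√x * l) = -1 → M.graph.IsBipartite →
      (Module.finrank 𝕜 ((M.standardLaplacian 𝕜).unboundedEigenspace (x : 𝕜)) : ℤ) =
        Fintype.card E - Fintype.card V + 2) ∧
    (∀ x : ℝ, 0 < x → Real.cos (√x * l) = -1 → ¬ M.graph.IsBipartite →
      (Module.finrank 𝕜 ((M.standardLaplacian 𝕜).unboundedEigenspace (x : 𝕜)) : ℤ) =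
        Fintype.card E - Fintype.card V) := by
  have h0 := M.finrank_eigenspace_zero (𝕜 := 𝕜)
  refine ⟨?_, fun x _ => M.finiteDimensional_eigenspace _, h0, fun x hx hs => ?_,
    fun x hx hc => M.finrank_eigenspace_of_cos_eq_one hl hx hc,
    fun x hx hc hM => M.finrank_eigenspace_of_bipartite hl hx hc hM,
    fun x hx hc hM => M.finrank_eigenspace_of_not_bipartite hl hx hc hM⟩
  · ext z
    rw [MetricGraph.mem_spectrum_iff]
    constructor
    · intro hz
      -- A spectral point is a priori any scalar of `𝕜`; the energy identity makes it real and
      -- nonnegative.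
      obtain ⟨x, hx, rfl⟩ := MetricGraph.exists_nonneg_of_eigenvalue hz
      refine ⟨x, ?_, rfl⟩
      rcases hx.eq_or_lt with rfl | hx
      · exact Or.inl (Or.inl rfl)
      · rcases (MetricGraph.finrank_eigenspace_pos_iff hl hx).1 hz with h | h
        · exact Or.inl (Or.inr ⟨hx, h⟩)
        · exact Or.inr ⟨hx, h⟩
    · rintro ⟨x, (rfl | ⟨hx, h⟩) | ⟨hx, h⟩, rfl⟩
      · beta_reduce
        rw [RCLike.ofReal_zero, h0]
        exact one_pos
      · exact (MetricGraph.finrank_eigenspace_pos_iff hl hx).2 (Or.inl h)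
      · exact (MetricGraph.finrank_eigenspace_pos_iff hl hx).2 (Or.inr h)
  · rw [M.finrank_eigenspace_of_sin_ne_zero hl hx hs]
    rfl
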